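/- Let $k$ be a finite field with $q$ elements, $\bar k$ its algebraic closure, and let $F$ raise every coordinate of a point of an affine or vector space over $\bar k$ to its $q$-th power. For a connected linear algebraic group $G$ defined over $k$, a $G$-module $V=\bar k^d$ of dimension $d\ge 1$ defined over $k$ (row vectors, with $G$ acting from the right), and $c\in G$, let $$E(k)=\{v\in V : v^F c=v\}$$ be the $k$-space of $F$-eigenvectors of $c$. Let $r$ be the minimum field degree of $c$, that is, the smallest $r\ge 1$ with $c^{F^r}=c$, and let $s$ be the order of $c^{F^{r-1}}\cdots c^Fc$ in $G$. Let $k_{rs}\subset\bar k$ be the extension of $k$ of degree $rs$; it contains the entries of the matrix of $c$ on $V$. Then, given $q,d,r,s$, the extension $k_{rs}$ (represented by a generator over $k$) and the matrix of $c$ on $V$, a $k$-basis of $E(k)$, consisting of $d$ vectors of $k_{rs}^{\,d}$, can be computed 1. by a deterministic algorithm in time $O(d^3r^3s^3\log^2 q)$; 2. by a Las Vegas algorithm in time $O(d^3r^2s^2\log^2 q)$, that is, by a randomised algorithm whose output is always correct and whose expected running time has this bound. In each case there is a single algorithm, and a single implied constant, for all $k,G,V,c$. Time is measured on a random access machine on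 which an arithmetic operation $(+,-,\times,{}^{-1})$, a copy, a comparison with $0$, or a uniform random choice in a field with $Q$ elements takes time $\lceil\log_2 Q\rceil$ (the fields being $k$ and $k_{rs}$; fetching the generator, embedding an element of $k$ in $k_{rs}$, and reading one coefficient, over $k$, of an element of $k_{rs}$ as a polynomial in the generator each count as an operation in $k_{rs}$), and additions, subtractions and comparisons of natural numbers, as well as memory accesses, take unit time. -/

import Mathlib

open scoped ENNReal

universe u

noncomputable section

namespace LangAlg

/-! ## Linear algebraic groups over the algebraic closure of a finite field -/

section AlgebraicGroups

variable (k : Type u) [Field k]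

/-- The map `F` on affine space: the `q`-th power of each coordinate, `q = |k|`. -/
def frob {ι : Type} (x : ι → AlgebraicClosure k) : ι → AlgebraicClosure k :=
  fun i => x i ^ Nat.card k

variable {k}

/-- An affine variety: the common zeroes of a collection of polynomials. -/
def IsAffineVariety {N : ℕ} (X : Set (Fin N → AlgebraicClosure k)) : Prop :=
  ∃ I : Set (MvPolynomial (Fin N) (AlgebraicClosure k)),
    X = {x | ∀ f ∈ I, MvPolynomial.eval x f = 0}

/-- Connectedness in the Zariski topology: a nonempty set that is not the union of two disjoint
nonempty closed subsets. -/
def IsZariskiConnected {N : ℕ} (X : Set (Fin N → AlgebraicClosure k)) : Prop :=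
  X.Nonempty ∧ ∀ A B : Set (Fin N → AlgebraicClosure k), IsAffineVariety A → IsAffineVariety B →
    A ∪ B = X → Disjoint A B → A = ∅ ∨ B = ∅

variable (k)

/-- A linear algebraic group defined over `k`, as the set of its points over the algebraic
closure: an affine variety with a group structure whose multiplication and inversion are
morphisms of varieties, such that the variety is stable under `F` and the multiplication
commutes with `F` (that is, variety and multiplication are defined over `k`). -/
structure LinearAlgebraicGroup (N : ℕ) where
  carrier : Set (Fin N → AlgebraicClosure k)
  isAffineVariety : IsAffineVariety carrier
  group : Group carrier
  mul_regular : ∃ m : Fin N → MvPolynomial (Fin N ⊕ Fin N) (AlgebraicClosure k),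
    ∀ (x y : carrier) (i : Fin N),
      (x * y).1 i = MvPolynomial.eval (Sum.elim x.1 y.1) (m i)
  inv_regular : ∃ m : Fin N → MvPolynomial (Fin N) (AlgebraicClosure k),
    ∀ (x : carrier) (i : Fin N), (x⁻¹).1 i = MvPolynomial.eval x.1 (m i)
  frob_mem : ∀ x ∈ carrier, frob k x ∈ carrier
  frob_mul : ∀ x y : carrier, frob k (x * y).1
    = ((⟨frob k x.1, frob_mem _ x.2⟩ : carrier) * ⟨frob k y.1, frob_mem _ y.2⟩ : carrier).1

attribute [instance] LinearAlgebraicGroup.group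

variable {k}

namespace LinearAlgebraicGroup

variable {N : ℕ} (G : LinearAlgebraicGroup k N)

/-- The Frobenius endomorphism `F` of `G`. -/
def frobenius : G.carrier →* G.carrier :=
  MonoidHom.mk' (fun x => ⟨frob k x.1, G.frob_mem _ x.2⟩) fun x y => Subtype.ext (G.frob_mul x y)

/-- `r` is the minimum field degree of `g`: the smallest positive `r` with `F ^ r` fixing `g`. -/
def IsMinFieldDegree (g : G.carrier) (r : ℕ) : Prop :=
  IsLeast {t : ℕ | 0 < t ∧ G.frobenius^[t] g = g} r

/-- The product `F ^ (r - 1) c * ⋯ * F c * c`. -/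
def twistedProd (c : G.carrier) : ℕ → G.carrier
  | 0 => 1
  | r + 1 => G.frobenius^[r] c * twistedProd c r

/-- A `G`-module of dimension `d` defined over `k`: a rational representation on row vectors of
length `d` (so that `g` maps `v` to `v * ρ g`) which commutes with `F`. -/
structure RatModule (d : ℕ) where
  ρ : G.carrier →* Matrix.GeneralLinearGroup (Fin d) (AlgebraicClosure k)
  regular : ∃ P : Fin d → Fin d → MvPolynomial (Fin N) (AlgebraicClosure k),
    ∀ (g : G.carrier) (i j : Fin d), (ρ g).1 i j = MvPolynomial.eval g.1 (P i j)
  frob_comm : ∀ (g : G.carrier) (i j : Fin d),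
    (ρ (G.frobenius g)).1 i j = (ρ g).1 i j ^ Nat.card k

end LinearAlgebraicGroup

theorem frob_add [Finite k] {ι : Type} (x y : ι → AlgebraicClosure k) :
    frob k (x + y) = frob k x + frob k y := by
  have := Fintype.ofFinite k
  obtain ⟨p, hp⟩ := CharP.exists k
  obtain ⟨n, hpr, hn⟩ := FiniteField.card k p
  have : Fact p.Prime := ⟨hpr⟩
  have : CharP (AlgebraicClosure k) p := charP_of_injective_algebraMap
    (algebraMap k (AlgebraicClosure k)).injective p
  funext i
  simp only [frob, Pi.add_apply, Nat.card_eq_fintype_card, hn]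
  exact add_pow_char_pow (x i) (y i) p n

theorem frob_smul [Finite k] {ι : Type} (a : k) (x : ι → AlgebraicClosure k) :
    frob k (a • x) = a • frob k x := by
  have := Fintype.ofFinite k
  funext i
  simp only [frob, Pi.smul_apply, Algebra.smul_def, mul_pow, ← map_pow, Nat.card_eq_fintype_card,
    FiniteField.pow_card]

/-- The `k`-space `E(k)` of `F`-eigenvectors of `c`: the row vectors `v` with `F v * c = v`. -/
def fEigenvectors [Finite k] {N : ℕ} {G : LinearAlgebraicGroup k N} {d : ℕ} (V : G.RatModule d)
    (c : G.carrier) : Submodule k (Fin d → AlgebraicClosure k) where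
  carrier := {v | Matrix.vecMul (frob k v) (V.ρ c).1 = v}
  add_mem' := by
    intro v w hv hw
    simp only [Set.mem_ofPred_eq] at *
    rw [frob_add, Matrix.add_vecMul, hv, hw]
  zero_mem' := by
    have h : frob k (0 : Fin d → AlgebraicClosure k) = 0 := by
      funext i
      simp [frob, Nat.card_pos.ne']
    simp [h]
  smul_mem' := by
    intro a v hv
    simp only [Set.mem_ofPred_eq] at *
    rw [frob_smul, Matrix.smul_vecMul, hv]

end AlgebraicGroups

/-! ## Random access programs over a finite field and a finite extension of it

A program works with three kinds of memory: natural numbers (sizes, loop counters, addresses),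
elements of the base field `k`, and elements of the extension field `K`. Each memory consists of
two-dimensional arrays with unbounded index ranges.
Elements of `K` are represented as polynomials in a fixed generator of `K` over `k`.

Each arithmetic operation, copy, comparison with zero or random choice in a field with `Q`
elements takes time `⌈log₂ Q⌉`. Natural numbers can only be added, subtracted and compared, in unit
time, as is usual for random access machines. -/

/-- A memory: `m a i j` is the content of the cell `(i, j)` of the array number `a`. -/
abbrev Mem (α : Type*) := ℕ → ℕ → ℕ → α

def Mem.set {α : Type*} (m : Mem α) (a i j : ℕ) (v : α) : Mem α :=
  fun a₁ i₁ j₁ => if a₁ = a ∧ i₁ = i ∧ j₁ = j then v else m a₁ i₁ j₁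

/-- Expressions with values in the natural numbers; `cell a i j` reads the cell `(i, j)` of the
array `a`, and `sub` is truncated subtraction. -/
inductive IExpr
  | lit (n : ℕ)
  | cell (a : ℕ) (i j : IExpr)
  | add (e f : IExpr)
  | sub (e f : IExpr)

namespace IExpr

def eval (m : Mem ℕ) : IExpr → ℕ
  | lit n => n
  | cell a i j => m a (i.eval m) (j.eval m)
  | add e f => e.eval m + f.eval m
  | sub e f => e.eval m - f.eval m

/-- The number of operations in an expression, which is the time its evaluation takes. -/
def cost : IExpr → ℕ
  | lit _ => 1
  | cell _ i j => i.cost + j.cost + 1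
  | add e f => e.cost + f.cost + 1
  | sub e f => e.cost + f.cost + 1

end IExpr

/-- A reference to a memory cell, with computed row and column. -/
structure Ref where
  arr : ℕ
  row : IExpr
  col : IExpr

namespace Ref

def get {α : Type*} (x : Ref) (n : Mem ℕ) (m : Mem α) : α :=
  m x.arr (x.row.eval n) (x.col.eval n)

def set {α : Type*} (x : Ref) (n : Mem ℕ) (m : Mem α) (v : α) : Mem α :=
  m.set x.arr (x.row.eval n) (x.col.eval n) v

def cost (x : Ref) : ℕ := x.row.cost + x.col.cost + 1

end Ref

/-- The operations of a field. -/
inductive FieldOp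
  | zero
  | one
  | copy (x : Ref)
  | add (x y : Ref)
  | sub (x y : Ref)
  | mul (x y : Ref)
  | inv (x : Ref)

namespace FieldOp

def eval {F : Type*} [Field F] (n : Mem ℕ) (m : Mem F) : FieldOp → F
  | zero => 0
  | one => 1
  | copy x => x.get n m
  | add x y => x.get n m + y.get n m
  | sub x y => x.get n m - y.get n m
  | mul x y => x.get n m * y.get n m
  | inv x => (x.get n m)⁻¹

/-- The time for the addressing of the operands. -/
def cost : FieldOp → ℕ
  | zero => 0
  | one => 0
  | copy x => x.cost
  | add x y => x.cost + y.cost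
  | sub x y => x.cost + y.cost
  | mul x y => x.cost + y.cost
  | inv x => x.cost

end FieldOp

/-- The tests of branches and loops: a comparison of natural numbers, or a comparison with zero
of an element of the base field or of the extension field. -/
inductive Test
  | lt (e f : IExpr)
  | baseIsZero (x : Ref)
  | extIsZero (x : Ref)

/-- Programs. -/
inductive Cmd
  /-- do nothing -/
  | skip
  /-- assignment to a cell of the memory of natural numbers -/
  | natSet (x : Ref) (e : IExpr)
  /-- operation in the base field -/
  | baseOp (x : Ref) (o : FieldOp)
  /-- operation in the extension field -/
  | extOp (x : Ref) (o : FieldOp)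
  /-- `x` becomes the generator of the extension field -/
  | gen (x : Ref)
  /-- `x` becomes the element `y` of the base field, as an element of the extension field -/
  | embed (x y : Ref)
  /-- `x` becomes the `e`-th coefficient of the element `y` of the extension field -/
  | coeff (x y : Ref) (e : IExpr)
  /-- `x` becomes a random element of the extension field, uniform and independent -/
  | rand (x : Ref)
  /-- first `a`, then `b` -/
  | seq (a b : Cmd)
  /-- if `t` then `a` else `b` -/
  | branch (t : Test) (a b : Cmd)
  /-- while `t` do `a` -/
  | loop (t : Test) (a : Cmd)

/-- A program is deterministic if it contains no random choice. -/
def Cmd.Deterministic : Cmd → Prop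
  | .rand _ => False
  | .seq a b => a.Deterministic ∧ b.Deterministic
  | .branch _ a b => a.Deterministic ∧ b.Deterministic
  | .loop _ a => a.Deterministic
  | _ => True

/-- The time of an operation in a field with `Q` elements: `⌈log₂ Q⌉`. -/
def opCost (F : Type*) : ℕ := Nat.clog 2 (Nat.card F)

section Semantics

variable (k K : Type*) [Field k] [Field K] [Algebra k K]

/-- The contents of the three memories. -/
structure State where
  nat : Mem ℕ
  base : Mem k
  ext : Mem K

variable {k K}

open Classical in
def Test.eval (σ : State k K) : Test → Bool
  | .lt e f => decide (e.eval σ.nat < f.eval σ.nat)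
  | .baseIsZero x => decide (x.get σ.nat σ.base = 0)
  | .extIsZero x => decide (x.get σ.nat σ.ext = 0)

variable (k K)

def Test.cost : Test → ℕ
  | .lt e f => e.cost + f.cost + 1
  | .baseIsZero x => x.cost + opCost k
  | .extIsZero x => x.cost + opCost K

/-- A configuration: the stack of the commands that remain to be executed, and the memory.
It is halted when the stack is empty. -/
abbrev Config := List Cmd × State k K

/-- The time of the next step. -/
def stepCost : Config k K → ℕ
  | ([], _) => 0
  | (.skip :: _, _) => 1
  | (.natSet x e :: _, _) => x.cost + e.cost
  | (.baseOp x o :: _, _) => x.cost + o.cost + opCost k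
  | (.extOp x o :: _, _) => x.cost + o.cost + opCost K
  | (.gen x :: _, _) => x.cost + opCost K
  | (.embed x y :: _, _) => x.cost + y.cost + opCost K
  | (.coeff x y e :: _, _) => x.cost + y.cost + e.cost + opCost K
  | (.rand x :: _, _) => x.cost + opCost K
  | (.seq _ _ :: _, _) => 1
  | (.branch t _ _ :: _, _) => t.cost k K
  | (.loop t _ :: _, _) => t.cost k K

variable {k K}

/-- The `i`-th coefficient of `y` as a polynomial of degree less than `[K : k]` in the generator. -/
def coeffAt (pb : PowerBasis k K) (y : K) (i : ℕ) : k :=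
  if h : i < pb.dim then pb.basis.repr y ⟨i, h⟩ else 0

/-- The next step. The argument `z` is a fresh random element of `K`; only `rand` uses it. -/
def step (pb : PowerBasis k K) (z : K) : Config k K → Config k K
  | ([], σ) => ([], σ)
  | (.skip :: l, σ) => (l, σ)
  | (.natSet x e :: l, σ) => (l, { σ with nat := x.set σ.nat σ.nat (e.eval σ.nat) })
  | (.baseOp x o :: l, σ) => (l, { σ with base := x.set σ.nat σ.base (o.eval σ.nat σ.base) })
  | (.extOp x o :: l, σ) => (l, { σ with ext := x.set σ.nat σ.ext (o.eval σ.nat σ.ext) })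
  | (.gen x :: l, σ) => (l, { σ with ext := x.set σ.nat σ.ext pb.gen })
  | (.embed x y :: l, σ) =>
      (l, { σ with ext := x.set σ.nat σ.ext (algebraMap k K (y.get σ.nat σ.base)) })
  | (.coeff x y e :: l, σ) =>
      (l, { σ with base := x.set σ.nat σ.base (coeffAt pb (y.get σ.nat σ.ext) (e.eval σ.nat)) })
  | (.rand x :: l, σ) => (l, { σ with ext := x.set σ.nat σ.ext z })
  | (.seq a b :: l, σ) => (a :: b :: l, σ)
  | (.branch t a b :: l, σ) => ((if t.eval σ then a else b) :: l, σ)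
  | (.loop t a :: l, σ) => (if t.eval σ then a :: .loop t a :: l else l, σ)

/-- `c₁` can be reached from `c` with some sequence of random elements. -/
def Reaches (pb : PowerBasis k K) : Config k K → Config k K → Prop :=
  Relation.ReflTransGen fun c c₁ => ∃ z, step pb z c = c₁

/-- The expected time of the first `n` steps, for independent random elements with uniform
distribution on the finite field `K`. -/
def expectedCost (pb : PowerBasis k K) : ℕ → Config k K → ℝ≥0∞
  | 0, _ => 0
  | n + 1, c =>
      (stepCost k K c : ℝ≥0∞) + (∑' z : K, expectedCost pb n (step pb z c)) / (Nat.card K : ℝ≥0∞)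

/-- The expected total running time. Each step before halting takes time at least `1`, so a finite
value implies that the program halts with probability one. The running time of a deterministic
program does not depend on the random elements and is equal to this value. -/
def expectedTime (pb : PowerBasis k K) (c : Config k K) : ℝ≥0∞ := ⨆ n, expectedCost pb n c

/-- The initial memory on input `q`, `d`, `r`, `s` (in the array `0` of natural numbers, in the rows
`0` to `3` of column `0`) and the `d × d` matrix `M` (in the array `0` of the memory of `K`);
all other cells contain `0`. -/
def initState {d : ℕ} (q r s : ℕ) (M : Matrix (Fin d) (Fin d) K) : State k K where
  nat := fun a i j => if a = 0 ∧ j = 0 then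
    (match i with | 0 => q | 1 => d | 2 => r | 3 => s | _ => 0) else 0
  base := fun _ _ _ => 0
  ext := fun a i j => if h : a = 0 ∧ i < d ∧ j < d then M ⟨i, h.2.1⟩ ⟨j, h.2.2⟩ else 0

/-- The output: the `d × d` matrix in the array `1` of the memory of `K`. -/
def State.output (σ : State k K) (d : ℕ) : Matrix (Fin d) (Fin d) K :=
  fun i j => σ.ext 1 i j

end Semantics

/-- The program `P` computes bases of the spaces of `F`-eigenvectors in expected time at most
`T d r s q`: for every connected linear algebraic group `G` defined over a finite field `k` with
`q` elements, every `G`-module `V` of dimension `d` defined over `k`, every `c` in `G` of minimum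
field degree `r` such that `F ^ (r - 1) c * ⋯ * F c * c` has order `s`, and every representation
of the extension `K` of degree `r * s` of `k` by a generator, the input being the matrix of the
action of `c` on `V`, which has entries in `K`.
Whenever `P` halts, the rows of the output form a `k`-basis of `E(k)`. -/
def ComputesFEigenbasis (P : Cmd) (T : ℕ → ℕ → ℕ → ℕ → ℝ) : Prop :=
  ∀ (k : Type u) [Field k] [Finite k] (N d : ℕ) (G : LinearAlgebraicGroup k N)
    (V : G.RatModule d) (c : G.carrier) (r s : ℕ),
    IsZariskiConnected G.carrier → 1 ≤ d → G.IsMinFieldDegree c r →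
    s = orderOf (G.twistedProd c r) →
    ∀ (K : IntermediateField k (AlgebraicClosure k)) (pb : PowerBasis k K),
      Module.finrank k K = r * s →
      ∃ M : Matrix (Fin d) (Fin d) K, M.map (algebraMap K (AlgebraicClosure k)) = (V.ρ c).1 ∧
        expectedTime pb ([P], initState (Nat.card k) r s M)
          ≤ ENNReal.ofReal (T d r s (Nat.card k)) ∧
        ∀ σ : State k K, Reaches pb ([P], initState (Nat.card k) r s M) ([], σ) →
          ∃ b : Module.Basis (Fin d) k (fEigenvectors V c),
            ∀ i j, (b i).1 j = algebraMap K (AlgebraicClosure k) (σ.output d i j)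

end LangAlg

end

/-! Put `n = r * s` and `K = k_{rs}`, and let `φ v = v^F c` on row vectors over `K` (`twist`). It is
additive, `k`-linear and `q`-semilinear. Since `φ^n v = v^{F^n} · c^{F^{n-1}} ⋯ c^F c`, and for `n =
r * s` this product is the `s`-th power of an element of order `s`, the map `φ^n` is the identity on
`K^d`. Hence the trace `T v = v + φ v + ⋯ + φ^{n-1} v` takes values in `E(k)`
(`twist_twistedTrace`).

The values of `T` span `K^d` over `K` (`span_range_twistedTrace`): if a linear form `f` kills all `T
(x e_i)`, then `∑ x^{q^l} a_l = 0` for all `x` in `K`, with `a_0 = f e_i`. The powers of Frobenius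
are distinct automorphisms, so Dedekind's independence theorem gives `a_0 = 0`. So some `d` traces
are independent over `K`, and any `d` such fixed vectors form a `k`-basis of `E(k)`: the coordinates
of an eigenvector with respect to them satisfy `a^q = a` (`exists_basis_fEigenvectors`).

It remains to find `d` independent traces. Traces are put one by one through an incremental
elimination that keeps a triangular matrix and stores a trace when it is new. One trace needs `O(n
d^2 log q)` operations in `K`, each of cost at most `n ⌈log₂ q⌉`. The deterministic program runs
through the `n d` vectors `gen^j e_i`, which span `K^d` over `k`. The Las Vegas program takes random
vectors: for a proper subspace `S` the preimage `T⁻¹ S` is a proper subgroup, so a trial fails with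
probability at most `1/2`, and `2 d` trials suffice on average.

Running times are bounded by a weakest-precondition calculus: `ert` is the expected time plus the
expected value of a function of the final state. With a function that is infinite on wrong final
states (`failure`), one finite bound proves both the time estimate and the correctness of every
reachable output. -/

noncomputable section

namespace LangAlg

/-! ### Expected running times as weakest preconditions. -/

section ExpectedTime

variable {k K : Type*} [Field k] [Field K] [Algebra k K]

/-- The expected value of the running time of a program plus `f` of the final state. -/
def ert (pb : PowerBasis k K) : Cmd → (State k K → ℝ≥0∞) → State k K → ℝ≥0∞
  | .rand x, f, σ => ((x.cost + opCost K : ℕ) : ℝ≥0∞)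
      + (∑' z : K, f { σ with ext := x.set σ.nat σ.ext z }) / (Nat.card K : ℝ≥0∞)
  | .seq a b, f, σ => 1 + ert pb a (ert pb b f) σ
  | .branch t a b, f, σ => (t.cost k K : ℝ≥0∞) + if t.eval σ then ert pb a f σ else ert pb b f σ
  -- The least function that is at least its own unrolling; it may be `∞`. Every such function is an
  -- upper bound for the loop.
  | .loop t a, f, σ =>
      sInf {I : State k K → ℝ≥0∞ |
        (fun σ => (t.cost k K : ℝ≥0∞) + if t.eval σ then ert pb a I σ else f σ) ≤ I} σ
  -- The remaining commands ignore the random element, so `0` is a dummy.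
  | c, f, σ => (stepCost k K ([c], σ) : ℝ≥0∞) + f (step pb 0 ([c], σ)).2

variable (pb : PowerBasis k K)

/-- Monotonicity is what lets Knaster–Tarski apply to loops. -/
theorem ert_mono (c : Cmd) : Monotone (ert pb c) := by
  induction c with
  | rand x =>
    intro f g h σ
    simp only [ert]
    gcongr
    exact h _
  | seq a b ha hb =>
    intro f g h σ
    simp only [ert]
    gcongr
    exact ha (hb h) σ
  | branch t a b ha hb =>
    intro f g h σ
    simp only [ert]
    gcongr
    split_ifs
    · exact ha h σ
    · exact hb h σ
  | loop t a ha =>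
    intro f g h σ
    simp only [ert]
    refine Pi.le_def.1 (sInf_le_sInf ?_) σ
    intro I hI τ
    refine le_trans ?_ (hI τ)
    dsimp only
    gcongr
    split_ifs
    · exact le_rfl
    · exact h τ
  | _ =>
    intro f g h σ
    simp only [ert]
    gcongr
    exact h _

/-- The functional of which the expected running time of a loop is the least fixed point. -/
def loopFunctional (t : Test) (a : Cmd) (f : State k K → ℝ≥0∞) :
    (State k K → ℝ≥0∞) →o (State k K → ℝ≥0∞) where
  toFun I σ := (t.cost k K : ℝ≥0∞) + if t.eval σ then ert pb a I σ else f σ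
  monotone' I J h σ := by
    dsimp only
    gcongr
    split_ifs
    · exact ert_mono pb a h σ
    · exact le_rfl

/-- Knaster–Tarski: the infimum of the pre-fixed points is itself a fixed point. -/
theorem ert_loop (t : Test) (a : Cmd) (f : State k K → ℝ≥0∞) (σ : State k K) :
    ert pb (.loop t a) f σ
      = (t.cost k K : ℝ≥0∞) + if t.eval σ then ert pb a (ert pb (.loop t a) f) σ else f σ := by
  have h : ert pb (.loop t a) f = (loopFunctional pb t a f).lfp := by
    funext σ
    simp only [ert]
    rfl
  rw [h]
  exact congrFun (loopFunctional pb t a f).map_lfp.symm σ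

/-- Park induction: a potential that pays for one pass and for the potential afterwards bounds the
whole loop. No separate termination argument is needed. -/
theorem ert_loop_le {t : Test} {a : Cmd} {f I : State k K → ℝ≥0∞}
    (h : ∀ σ, (t.cost k K : ℝ≥0∞) + (if t.eval σ then ert pb a I σ else f σ) ≤ I σ)
    (σ : State k K) : ert pb (.loop t a) f σ ≤ I σ := by
  simp only [ert]
  refine Pi.le_def.1 (sInf_le ?_) σ
  exact h

/-- The expected value of the remaining running time plus `f` of the final state. -/
def ertList (f : State k K → ℝ≥0∞) : List Cmd → State k K → ℝ≥0∞
  | [] => f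
  | c :: l => ert pb c (ertList f l)

theorem card_mul_div_card [Finite K] (a : ℝ≥0∞) :
    ((ENat.card K : ℕ∞) : ℝ≥0∞) * a / (Nat.card K : ℝ≥0∞) = a := by
  rw [ENat.card_eq_coe_natCard, ENat.toENNReal_coe, mul_comm]
  exact ENNReal.mul_div_cancel_right (Nat.cast_ne_zero.2 Nat.card_pos.ne') (by simp)

/-- Soundness of the calculus for a single machine step: `ertList` is a potential whose expected
decrease pays for the step. Iterating it bounds `expectedCost`. -/
theorem stepCost_add_le_ertList [Finite K] (f : State k K → ℝ≥0∞) (c : Config k K) :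
    (stepCost k K c : ℝ≥0∞)
      + (∑' z : K, ertList pb f (step pb z c).1 (step pb z c).2) / (Nat.card K : ℝ≥0∞)
      ≤ ertList pb f c.1 c.2 := by
  obtain ⟨l, σ⟩ := c
  cases l with
  | nil => simp [stepCost, step, card_mul_div_card]
  | cons c l =>
    cases c with
    | rand x => simp [stepCost, step, ertList, ert]
    | seq a b => simp [stepCost, step, ertList, ert, card_mul_div_card]
    | branch t a b =>
      by_cases h : t.eval σ <;> simp [stepCost, step, ertList, ert, card_mul_div_card, h]
    | loop t a =>
      simp only [ertList]
      rw [ert_loop]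
      by_cases h : t.eval σ <;> simp [stepCost, step, ertList, card_mul_div_card, h]
    | _ => simp [stepCost, step, ertList, ert, card_mul_div_card]

theorem expectedCost_le_ertList [Finite K] (f : State k K → ℝ≥0∞) (n : ℕ) (c : Config k K) :
    expectedCost pb n c ≤ ertList pb f c.1 c.2 := by
  induction n generalizing c with
  | zero => simp [expectedCost]
  | succ n ih =>
    refine le_trans ?_ (stepCost_add_le_ertList pb f c)
    simp only [expectedCost]
    gcongr
    exact ih _

theorem expectedTime_le_ert [Finite K] (f : State k K → ℝ≥0∞) (P : Cmd) (σ : State k K) :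
    expectedTime pb ([P], σ) ≤ ert pb P f σ :=
  iSup_le fun n => expectedCost_le_ertList pb f n ([P], σ)

/-- Each element of the finite field `K` has positive probability, so a finite average has only
finite terms. -/
theorem ertList_step_lt_top [Finite K] (f : State k K → ℝ≥0∞) (c : Config k K) (z : K)
    (h : ertList pb f c.1 c.2 < ∞) :
    ertList pb f (step pb z c).1 (step pb z c).2 < ∞ := by
  have h1 := lt_of_le_of_lt (le_trans le_add_self (stepCost_add_le_ertList pb f c)) h
  have h2 : (∑' z : K, ertList pb f (step pb z c).1 (step pb z c).2) < ∞ := by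
    by_contra h3
    rw [not_lt, top_le_iff] at h3
    rw [h3, ENNReal.top_div_of_ne_top (by simp)] at h1
    exact lt_irrefl _ h1
  exact lt_of_le_of_lt (ENNReal.le_tsum z) h2

/-- Turns a time bound into correctness: if `f` is `∞` on bad states, a finite `ert` shows that no
sequence of random choices ends in one. -/
theorem lt_top_of_reaches [Finite K] (f : State k K → ℝ≥0∞) {P : Cmd} {σ τ : State k K}
    (h : ert pb P f σ < ∞) (hr : Reaches pb ([P], σ) ([], τ)) : f τ < ∞ := by
  have key : ∀ c : Config k K, Reaches pb ([P], σ) c → ertList pb f c.1 c.2 < ∞ := by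
    intro c hc
    induction hc with
    | refl => exact h
    | tail _ h1 ih =>
      obtain ⟨z, rfl⟩ := h1
      exact ertList_step_lt_top pb f _ z ih
  exact key _ hr

/-- From `σ`, the program `c` terminates in time at most `T`, in a state that satisfies `Q` and
does not depend on random choices. -/
def Trip (c : Cmd) (σ : State k K) (T : ℕ) (Q : State k K → Prop) : Prop :=
  ∃ τ, (∀ f, ert pb c f σ ≤ T + f τ) ∧ Q τ

variable {pb}

namespace Trip

variable {a b : Cmd} {σ : State k K} {T T₁ T₂ : ℕ} {Q R : State k K → Prop}

theorem conseq (h : Trip pb a σ T₁ Q) (hT : T₁ ≤ T) (hQ : ∀ τ, Q τ → R τ) : Trip pb a σ T R := by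
  obtain ⟨τ, h1, h2⟩ := h
  refine ⟨τ, fun f => (h1 f).trans ?_, hQ τ h2⟩
  gcongr

theorem mono (hT : T₁ ≤ T) (h : Trip pb a σ T₁ Q) : Trip pb a σ T Q := h.conseq hT fun _ => id

theorem imp (h : Trip pb a σ T Q) (hQ : ∀ τ, Q τ → R τ) : Trip pb a σ T R := h.conseq le_rfl hQ

theorem skip (h : Q σ) : Trip pb .skip σ 1 Q :=
  ⟨σ, fun f => by simp [ert, stepCost, step], h⟩

theorem natSet {x : Ref} {e : IExpr}
    (h : Q { σ with nat := x.set σ.nat σ.nat (e.eval σ.nat) }) :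
    Trip pb (.natSet x e) σ (x.cost + e.cost) Q :=
  ⟨_, fun f => by simp [ert, stepCost, step], h⟩

theorem extOp {x : Ref} {o : FieldOp}
    (h : Q { σ with ext := x.set σ.nat σ.ext (o.eval σ.nat σ.ext) }) :
    Trip pb (.extOp x o) σ (x.cost + o.cost + opCost K) Q :=
  ⟨_, fun f => by simp [ert, stepCost, step], h⟩

theorem gen {x : Ref} (h : Q { σ with ext := x.set σ.nat σ.ext pb.gen }) :
    Trip pb (.gen x) σ (x.cost + opCost K) Q :=
  ⟨_, fun f => by simp [ert, stepCost, step], h⟩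

theorem seq (h : Trip pb a σ T₁ fun τ => Trip pb b τ T₂ Q) :
    Trip pb (.seq a b) σ (T₁ + T₂ + 1) Q := by
  obtain ⟨τ, h1, υ, h2, h3⟩ := h
  refine ⟨υ, fun f => ?_, h3⟩
  calc ert pb (.seq a b) f σ = 1 + ert pb a (ert pb b f) σ := by simp only [ert]
    _ ≤ 1 + (T₁ + (T₂ + f υ)) := by
      gcongr
      exact (h1 _).trans (by gcongr; exact h2 f)
    _ = ((T₁ + T₂ + 1 : ℕ) : ℝ≥0∞) + f υ := by
      push_cast
      ring

theorem branch {t : Test} (ht : t.eval σ = true → Trip pb a σ T Q)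
    (hf : t.eval σ = false → Trip pb b σ T Q) :
    Trip pb (.branch t a b) σ (t.cost k K + T) Q := by
  rcases h : t.eval σ with _ | _
  · obtain ⟨τ, h1, h2⟩ := hf h
    refine ⟨τ, fun f => ?_, h2⟩
    simp only [ert, h, Nat.cast_add, add_assoc]
    gcongr
    exact h1 f
  · obtain ⟨τ, h1, h2⟩ := ht h
    refine ⟨τ, fun f => ?_, h2⟩
    simp only [ert, h, Nat.cast_add, add_assoc]
    gcongr
    exact h1 f

/-- A loop whose `i`-th pass preserves an invariant and which ends after `N` passes. -/
theorem loop {t : Test} {N : ℕ} (I : ℕ → State k K → Prop) (h0 : I 0 σ)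
    (hN : ∀ τ, I N τ → t.eval τ = false)
    (hi : ∀ i < N, ∀ τ, I i τ → t.eval τ = true ∧ Trip pb a τ T (I (i + 1))) :
    Trip pb (.loop t a) σ (N * (T + t.cost k K) + t.cost k K) (I N) := by
  -- Induction on the number `n` of passes that remain.
  have key : ∀ n, ∀ i, i + n = N → ∀ τ, I i τ →
      Trip pb (.loop t a) τ (n * (T + t.cost k K) + t.cost k K) (I N) := by
    intro n
    induction n with
    | zero =>
      intro i hiN τ hτ
      obtain rfl : i = N := hiN
      refine ⟨τ, fun f => ?_, hτ⟩
      rw [ert_loop, hN τ hτ]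
      simp
    | succ n ih =>
      intro i hiN τ hτ
      obtain ⟨h1, υ, h2, h3⟩ := hi i (by omega) τ hτ
      obtain ⟨ω, h4, h5⟩ := ih (i + 1) (by omega) υ h3
      refine ⟨ω, fun f => ?_, h5⟩
      rw [ert_loop, h1]
      simp only [if_true]
      calc (t.cost k K : ℝ≥0∞) + ert pb a (ert pb (.loop t a) f) τ
          ≤ (t.cost k K : ℝ≥0∞)
            + (T + (((n * (T + t.cost k K) + t.cost k K : ℕ) : ℝ≥0∞) + f ω)) := by
            gcongr
            exact (h2 _).trans (by gcongr; exact h4 f)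
        _ = _ := by
            push_cast
            ring
  exact key N 0 (by omega) σ h0

end Trip

end ExpectedTime

/-! ### The semilinear map `v ↦ v^F M`, its iterates and its trace. -/

section TwistedFrobenius

variable (k : Type*) {K : Type*} [Field K] {d : ℕ}

/-- The map that applies the `q`-th power map to the coordinates of a row vector and multiplies
the result by a matrix. -/
def twist (M : Matrix (Fin d) (Fin d) K) (v : Fin d → K) : Fin d → K :=
  Matrix.vecMul (fun j => v j ^ Nat.card k) M

/-- The sum of the first `n` iterates of `twist` at a vector. -/
def twistedTrace (M : Matrix (Fin d) (Fin d) K) (n : ℕ) (v : Fin d → K) : Fin d → K :=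
  ∑ l ∈ Finset.range n, (twist k M)^[l] v

theorem map_twist {Ω : Type*} [Field Ω] [Algebra K Ω]
    (M : Matrix (Fin d) (Fin d) K) (v : Fin d → K) (i : Fin d) :
    algebraMap K Ω (twist k M v i)
      = twist k (M.map (algebraMap K Ω)) (fun j => algebraMap K Ω (v j)) i := by
  simp [twist, Matrix.vecMul, dotProduct]

theorem map_iterate_twist {Ω : Type*} [Field Ω] [Algebra K Ω]
    (M : Matrix (Fin d) (Fin d) K) (n : ℕ) (v : Fin d → K) (i : Fin d) :
    algebraMap K Ω ((twist k M)^[n] v i)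
      = (twist k (M.map (algebraMap K Ω)))^[n] (fun j => algebraMap K Ω (v j)) i := by
  induction n generalizing v with
  | zero => rfl
  | succ n ih =>
    rw [Function.iterate_succ_apply, Function.iterate_succ_apply, ih]
    exact congrArg (fun w => (twist k (M.map (algebraMap K Ω)))^[n] w i)
      (funext fun j => map_twist k M v j)

variable [Field k] [Finite k] [Algebra k K]

theorem pow_card_add (x y : K) :
    (x + y) ^ Nat.card k = x ^ Nat.card k + y ^ Nat.card k := by
  have := Fintype.ofFinite k
  have h := map_add (FiniteField.frobeniusAlgHom k K) x y
  simp only [FiniteField.coe_frobeniusAlgHom] at h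
  rwa [← Nat.card_eq_fintype_card] at h

theorem sum_pow_card {ι : Type*} (s : Finset ι) (f : ι → K) :
    (∑ i ∈ s, f i) ^ Nat.card k = ∑ i ∈ s, f i ^ Nat.card k := by
  have := Fintype.ofFinite k
  have h := map_sum (FiniteField.frobeniusAlgHom k K) f s
  simp only [FiniteField.coe_frobeniusAlgHom] at h
  rwa [← Nat.card_eq_fintype_card] at h

theorem algebraMap_pow_card (a : k) : algebraMap k K a ^ Nat.card k = algebraMap k K a := by
  have := Fintype.ofFinite k
  rw [← map_pow, Nat.card_eq_fintype_card, FiniteField.pow_card]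

theorem twist_add (M : Matrix (Fin d) (Fin d) K) (v w : Fin d → K) :
    twist k M (v + w) = twist k M v + twist k M w := by
  simp only [twist, ← Matrix.add_vecMul]
  congr 1
  funext j
  exact pow_card_add k _ _

theorem twist_smul (M : Matrix (Fin d) (Fin d) K) (a : k) (v : Fin d → K) :
    twist k M (a • v) = a • twist k M v := by
  simp only [twist, ← Matrix.smul_vecMul]
  congr 1
  funext j
  simp only [Pi.smul_apply, Algebra.smul_def, mul_pow, algebraMap_pow_card]

/-- `twist` as a linear map over the base field. -/
def twistLin (M : Matrix (Fin d) (Fin d) K) : Module.End k (Fin d → K) where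
  toFun := twist k M
  map_add' := twist_add k M
  map_smul' := twist_smul k M

/-- `twistedTrace` as a linear map over the base field. -/
def twistedTraceLin (M : Matrix (Fin d) (Fin d) K) (n : ℕ) : Module.End k (Fin d → K) :=
  ∑ l ∈ Finset.range n, twistLin k M ^ l

theorem twistedTraceLin_apply (M : Matrix (Fin d) (Fin d) K) (n : ℕ) (v : Fin d → K) :
    twistedTraceLin k M n v = twistedTrace k M n v := by
  simp only [twistedTraceLin, twistedTrace, LinearMap.sum_apply, Module.End.pow_apply]
  rfl

/-- Applying `twist` shifts the summation index by one, and periodicity identifies the new last term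
with the lost first one. -/
theorem twist_twistedTrace (M : Matrix (Fin d) (Fin d) K) (n : ℕ) (v : Fin d → K)
    (h : (twist k M)^[n] v = v) : twist k M (twistedTrace k M n v) = twistedTrace k M n v := by
  have h1 : twist k M (twistedTrace k M n v)
      = ∑ l ∈ Finset.range n, (twist k M)^[l + 1] v := by
    rw [twistedTrace]
    refine (map_sum (twistLin k M) _ _).trans (Finset.sum_congr rfl fun l _ => ?_)
    rw [Function.iterate_succ_apply']
    rfl
  have h2 := Finset.sum_range_succ (fun l => (twist k M)^[l] v) n
  rw [Finset.sum_range_succ'] at h2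
  rw [h1, twistedTrace]
  simpa [h] using h2

/-- The matrix of the linear part of an iterate of `twist`. -/
def twistMatrix (M : Matrix (Fin d) (Fin d) K) : ℕ → Matrix (Fin d) (Fin d) K
  | 0 => 1
  | l + 1 => (twistMatrix M l).map (· ^ Nat.card k) * M

theorem iterate_twist (M : Matrix (Fin d) (Fin d) K) (l : ℕ) (v : Fin d → K) :
    (twist k M)^[l] v = Matrix.vecMul (fun j => v j ^ Nat.card k ^ l) (twistMatrix k M l) := by
  induction l with
  | zero => simp [twistMatrix]
  | succ l ih =>
    rw [Function.iterate_succ_apply', ih, twist, twistMatrix, ← Matrix.vecMul_vecMul]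
    congr 1
    funext j
    simp only [Matrix.vecMul, dotProduct, sum_pow_card, mul_pow, Matrix.map_apply, ← pow_mul,
      ← pow_succ]

variable [Finite K]

/-- Dedekind's theorem: the powers of Frobenius below `[K : k]` are distinct automorphisms of `K`
over `k`, hence linearly independent over `K`. All coefficients vanish, but only the first one is
needed. -/
theorem sum_pow_card_pow_eq_zero (a : ℕ → K)
    (h : ∀ x : K, ∑ l ∈ Finset.range (Module.finrank k K), x ^ Nat.card k ^ l * a l = 0) :
    a 0 = 0 := by
  have := Fintype.ofFinite k
  have hli := (linearIndependent_algHom_toLinearMap k K K).comp _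
    (FiniteField.bijective_frobeniusAlgHom_pow k K).1
  rw [Fintype.linearIndependent_iff] at hli
  have hpos : 0 < Module.finrank k K := Module.finrank_pos
  refine hli (fun i => a i) (LinearMap.ext fun x => ?_) ⟨0, hpos⟩
  have hx := h x
  rw [Finset.sum_range] at hx
  simp only [LinearMap.sum_apply, LinearMap.smul_apply, Function.comp_apply,
    AlgHom.toLinearMap_apply, AlgHom.coe_pow, FiniteField.coe_frobeniusAlgHom, pow_iterate,
    LinearMap.zero_apply, smul_eq_mul]
  rw [← hx]
  refine Finset.sum_congr rfl fun i _ => ?_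
  rw [Nat.card_eq_fintype_card, mul_comm]

theorem span_range_twistedTrace (M : Matrix (Fin d) (Fin d) K) :
    Submodule.span K (Set.range (twistedTrace k M (Module.finrank k K))) = ⊤ := by
  by_contra hne
  obtain ⟨f, hf, hle⟩ := Submodule.exists_le_ker_of_lt_top _ (lt_top_iff_ne_top.2 hne)
  refine hf (LinearMap.pi_ext' fun i => LinearMap.ext_ring ?_)
  -- On `x e_i` the `l`-th iterate is `x^{q^l}` times row `i` of `twistMatrix k M l`; for `l = 0`
  -- that row is `e_i`, so the vanishing coefficient is `f e_i`.
  have key := sum_pow_card_pow_eq_zero k (fun l => f (twistMatrix k M l i)) fun x => by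
    have hx : f (twistedTrace k M (Module.finrank k K) (Pi.single i x)) = 0 :=
      hle (Submodule.subset_span ⟨_, rfl⟩)
    rw [twistedTrace, map_sum] at hx
    rw [← hx]
    refine Finset.sum_congr rfl fun l _ => ?_
    rw [iterate_twist, ← smul_eq_mul, ← map_smul]
    congr 1
    have hs : (fun j => (Pi.single i x : Fin d → K) j ^ Nat.card k ^ l)
        = Pi.single i (x ^ Nat.card k ^ l) := by
      funext j
      by_cases hj : j = i
      · subst hj
        simp
      · simp [hj, Nat.card_pos.ne']
    rw [hs, Matrix.single_vecMul]
    rfl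
  have h1 : (1 : Matrix (Fin d) (Fin d) K) i = Pi.single i 1 := by
    funext j
    rw [Matrix.one_apply, Pi.single_apply]
    simp only [eq_comm]
  rw [twistMatrix, h1] at key
  simpa using key

/-- The preimage of `S` under the trace is an additive subgroup, proper because the traces span,
hence of index at least `2`. So a random trace falls into `S` with probability at most `1/2`. -/
theorem two_mul_card_twistedTrace_mem_le (M : Matrix (Fin d) (Fin d) K)
    {S : Submodule K (Fin d → K)} (hS : S ≠ ⊤) :
    2 * Nat.card {v // twistedTrace k M (Module.finrank k K) v ∈ S} ≤ Nat.card (Fin d → K) := by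
  set H : AddSubgroup (Fin d → K) :=
    ((S.restrictScalars k).comap (twistedTraceLin k M (Module.finrank k K))).toAddSubgroup
  have hmem : ∀ v, v ∈ H ↔ twistedTrace k M (Module.finrank k K) v ∈ S := fun v => by
    rw [← twistedTraceLin_apply]
    rfl
  have hH : H.index ≠ 1 := by
    rw [Ne, AddSubgroup.index_eq_one]
    intro htop
    apply hS
    rw [eq_top_iff, ← span_range_twistedTrace k M, Submodule.span_le]
    rintro _ ⟨v, rfl⟩
    exact (hmem v).1 (by rw [htop]; trivial)
  have h0 : H.index ≠ 0 := AddSubgroup.FiniteIndex.index_ne_zero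
  have hc : Nat.card {v // twistedTrace k M (Module.finrank k K) v ∈ S} = Nat.card H :=
    Nat.card_congr (Equiv.subtypeEquivRight fun v => (hmem v).symm)
  rw [hc, ← H.index_mul_card]
  exact Nat.mul_le_mul_right _ (by omega)

/-- The trace is only `k`-linear, so it has to be tested on a `k`-basis of `K^d`; this is where the
power basis enters. -/
theorem eq_top_of_twistedTrace_single_mem (M : Matrix (Fin d) (Fin d) K) (pb : PowerBasis k K)
    {S : Submodule K (Fin d → K)}
    (h : ∀ (i : Fin d) (j : ℕ), j < Module.finrank k K →
      twistedTrace k M (Module.finrank k K) (Pi.single i (pb.gen ^ j)) ∈ S) : S = ⊤ := by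
  rw [eq_top_iff, ← span_range_twistedTrace k M, Submodule.span_le]
  rintro _ ⟨v, rfl⟩
  set H := (S.restrictScalars k).comap (twistedTraceLin k M (Module.finrank k K))
  have hmem : ∀ v, v ∈ H ↔ twistedTrace k M (Module.finrank k K) v ∈ S := fun v => by
    rw [← twistedTraceLin_apply]
    rfl
  refine (hmem v).1 ?_
  have hsingle : ∀ (i : Fin d) (x : K), Pi.single i x ∈ H := by
    intro i x
    have hx : x ∈ Submodule.span k (Set.range pb.basis) := by
      rw [pb.basis.span_eq]
      trivial
    induction hx using Submodule.span_induction with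
    | mem x hx =>
      obtain ⟨j, rfl⟩ := hx
      rw [hmem, pb.basis_eq_pow]
      exact h i j (by rw [pb.finrank]; exact j.2)
    | zero => simp
    | add x y _ _ hx hy =>
      rw [Pi.single_add]
      exact H.add_mem hx hy
    | smul a x _ hx =>
      rw [Pi.single_smul]
      exact H.smul_mem a hx
  rw [← Finset.univ_sum_single v]
  exact H.sum_mem fun i _ => hsingle i _

end TwistedFrobenius

/-! ### From the group element to the fixed vectors: descent to `k` and `K`. -/

section AlgebraicGroups

/-- The elements of `L` already exhaust the at most `|L|` roots of `X^|L| - X`. -/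
theorem mem_range_algebraMap_of_pow_card_eq {L Ω : Type*} [Field L] [Finite L] [Field Ω]
    [Algebra L Ω] {x : Ω} (h : x ^ Nat.card L = x) : x ∈ Set.range (algebraMap L Ω) := by
  classical
  have := Fintype.ofFinite L
  by_contra hx
  have hcard : 1 < Nat.card L := Finite.one_lt_card
  have hdeg := FiniteField.X_pow_card_sub_X_natDegree_eq Ω hcard
  have hne : (Polynomial.X ^ Nat.card L - Polynomial.X : Polynomial Ω) ≠ 0 :=
    FiniteField.X_pow_card_sub_X_ne_zero Ω hcard
  have hle := Polynomial.card_le_degree_of_subset_roots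
    (p := (Polynomial.X ^ Nat.card L - Polynomial.X : Polynomial Ω))
    (Z := insert x (Finset.univ.image (algebraMap L Ω))) (by
      intro y hy
      rw [Polynomial.mem_roots hne, Polynomial.IsRoot.def]
      simp only [Polynomial.eval_sub, Polynomial.eval_pow, Polynomial.eval_X, sub_eq_zero]
      rw [Finset.mem_val, Finset.mem_insert] at hy
      rcases hy with rfl | hy
      · exact h
      · obtain ⟨a, -, rfl⟩ := Finset.mem_image.1 hy
        exact algebraMap_pow_card L a)
  rw [hdeg, Finset.card_insert_of_notMem (by simpa using hx),
    Finset.card_image_of_injective _ (algebraMap L Ω).injective, Finset.card_univ,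
    Nat.card_eq_fintype_card] at hle
  omega

variable {k : Type u} [Field k] {N d : ℕ} {G : LinearAlgebraicGroup k N}

theorem iterate_frob {ι : Type} (n : ℕ) (x : ι → AlgebraicClosure k) (i : ι) :
    (frob k)^[n] x i = x i ^ Nat.card k ^ n := by
  induction n with
  | zero => simp
  | succ n ih => rw [Function.iterate_succ_apply', frob, ih, ← pow_mul, pow_succ]

/-- The factors `F^i c` have period `r` in `i`, so a product over `r * s` factors is an `s`-th
power. -/
theorem twistedProd_add {c : G.carrier} {r : ℕ} (h : G.frobenius^[r] c = c) (m : ℕ) :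
    G.twistedProd c (m + r) = G.twistedProd c m * G.twistedProd c r := by
  induction m with
  | zero => simp [LinearAlgebraicGroup.twistedProd]
  | succ m ih =>
    rw [show m + 1 + r = m + r + 1 by ring, LinearAlgebraicGroup.twistedProd, ih,
      Function.iterate_add_apply, h, LinearAlgebraicGroup.twistedProd, mul_assoc]

theorem twistedProd_mul {c : G.carrier} {r : ℕ} (h : G.frobenius^[r] c = c) (s : ℕ) :
    G.twistedProd c (r * s) = G.twistedProd c r ^ s := by
  induction s with
  | zero => simp [LinearAlgebraicGroup.twistedProd]
  | succ s ih => rw [Nat.mul_succ, twistedProd_add h, ih, pow_succ]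

theorem rho_iterate_frobenius (V : G.RatModule d) (g : G.carrier) (n : ℕ) (i j : Fin d) :
    (V.ρ (G.frobenius^[n] g)).1 i j = (V.ρ g).1 i j ^ Nat.card k ^ n := by
  induction n with
  | zero => simp
  | succ n ih => rw [Function.iterate_succ_apply', V.frob_comm, ih, ← pow_mul, pow_succ]

/-- `F^r` fixes `c`, so `F^{rs}` does too, and the matrix entries are fixed by the `|K|`-th power
map. -/
theorem exists_matrix (V : G.RatModule d) {c : G.carrier} {r s : ℕ}
    {K : IntermediateField k (AlgebraicClosure k)} [Finite K]
    (h : G.frobenius^[r] c = c) (hK : Module.finrank k K = r * s) :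
    ∃ M : Matrix (Fin d) (Fin d) K, M.map (algebraMap K (AlgebraicClosure k)) = (V.ρ c).1 := by
  have hentry : ∀ i j, ∃ a : K, algebraMap K (AlgebraicClosure k) a = (V.ρ c).1 i j := by
    intro i j
    refine mem_range_algebraMap_of_pow_card_eq ?_
    rw [Module.natCard_eq_pow_finrank (K := k), hK, ← rho_iterate_frobenius,
      Function.iterate_mul, Function.iterate_fixed h]
  choose M hM using hentry
  exact ⟨Matrix.of M, by ext i j; exact hM i j⟩

variable [Finite k]

theorem iterate_frob_vecMul (n : ℕ) (v : Fin d → AlgebraicClosure k)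
    (V : G.RatModule d) (c : G.carrier) :
    (frob k)^[n] (Matrix.vecMul v (V.ρ c).1)
      = Matrix.vecMul ((frob k)^[n] v) (V.ρ (G.frobenius^[n] c)).1 := by
  induction n with
  | zero => rfl
  | succ n ih =>
    rw [Function.iterate_succ_apply', Function.iterate_succ_apply',
      Function.iterate_succ_apply', ih]
    funext j
    simp only [frob, Matrix.vecMul, dotProduct, sum_pow_card, mul_pow, V.frob_comm]

theorem iterate_twist_rho (V : G.RatModule d) (c : G.carrier) (n : ℕ)
    (v : Fin d → AlgebraicClosure k) :
    (twist k (V.ρ c).1)^[n] v = Matrix.vecMul ((frob k)^[n] v) (V.ρ (G.twistedProd c n)).1 := by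
  induction n generalizing v with
  | zero => simp [LinearAlgebraicGroup.twistedProd]
  | succ n ih =>
    rw [Function.iterate_succ_apply, ih]
    have h : twist k (V.ρ c).1 v = Matrix.vecMul (frob k v) (V.ρ c).1 := rfl
    rw [h, iterate_frob_vecMul, Matrix.vecMul_vecMul, LinearAlgebraicGroup.twistedProd, map_mul,
      Function.iterate_succ_apply]
    rfl

variable {V : G.RatModule d} {c : G.carrier} {r s : ℕ}
  {K : IntermediateField k (AlgebraicClosure k)}


/-- The rows are a basis of the whole space over the algebraic closure. Writing an eigenvector as `∑
a_i b_i` and applying `twist` raises each `a_i` to the `q`-th power, so uniqueness of coordinates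
puts every `a_i` in `k`. -/
theorem exists_basis_fEigenvectors {M : Matrix (Fin d) (Fin d) K}
    (hM : M.map (algebraMap K (AlgebraicClosure k)) = (V.ρ c).1) (B : Matrix (Fin d) (Fin d) K)
    (hB : ∀ i, twist k M (B i) = B i) (hspan : Submodule.span K (Set.range B) = ⊤) :
    ∃ b : Module.Basis (Fin d) k (fEigenvectors V c),
      ∀ i j, (b i).1 j = algebraMap K (AlgebraicClosure k) (B i j) := by
  set Ω := AlgebraicClosure k
  set B' : Matrix (Fin d) (Fin d) Ω := B.map (algebraMap K Ω) with hB'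
  have hunit : IsUnit B' := by
    have h1 : IsUnit B := by
      rw [← Matrix.linearIndependent_rows_iff_isUnit]
      exact linearIndependent_of_top_le_span_of_card_eq_finrank hspan.ge (by simp)
    exact h1.map (algebraMap K Ω).mapMatrix
  have hli : LinearIndependent Ω (fun i => B' i) :=
    Matrix.linearIndependent_rows_iff_isUnit.2 hunit
  have htw : ∀ i, twist k (V.ρ c).1 (B' i) = B' i := by
    intro i
    funext j
    rw [← hM]
    exact (map_twist k M (B i) j).symm.trans (congrArg _ (congrFun (hB i) j))
  have hmem : ∀ v, v ∈ fEigenvectors V c ↔ twist k (V.ρ c).1 v = v := fun v => Iff.rfl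
  let e : Fin d → fEigenvectors V c := fun i => ⟨B' i, (hmem _).2 (htw i)⟩
  have hek : LinearIndependent k e := by
    refine LinearIndependent.of_comp (fEigenvectors V c).subtype ?_
    exact hli.restrict_scalars' k
  have hes : ⊤ ≤ Submodule.span k (Set.range e) := by
    rintro ⟨v, hv⟩ -
    have hv' := (hmem v).1 hv
    obtain ⟨a, ha⟩ : ∃ a : Fin d → Ω, Matrix.vecMul a B' = v := by
      have hdet := (Matrix.isUnit_iff_isUnit_det _).1 hunit
      exact ⟨Matrix.vecMul v B'⁻¹, by
        rw [Matrix.vecMul_vecMul, Matrix.nonsing_inv_mul _ hdet, Matrix.vecMul_one]⟩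
    have hrow : ∀ a : Fin d → Ω, Matrix.vecMul a B' = ∑ i, a i • B' i := fun a =>
      Matrix.vecMul_eq_sum a B'
    have hfix : Matrix.vecMul (fun i => a i ^ Nat.card k) B' = Matrix.vecMul a B' := by
      rw [ha, ← hv', ← ha, hrow, hrow]
      refine Eq.trans ?_ (map_sum (twistLin k (V.ρ c).1) _ _).symm
      refine Finset.sum_congr rfl fun i _ => ?_
      have hs : ∀ (x : Ω) w, twist k (V.ρ c).1 (x • w)
          = x ^ Nat.card k • twist k (V.ρ c).1 w := by
        intro x w
        simp only [twist, ← Matrix.smul_vecMul]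
        congr 1
        funext j
        simp [mul_pow]
      exact (((hs _ _).trans (by rw [htw]))).symm
    have hak : ∀ i, ∃ y : k, algebraMap k Ω y = a i := by
      intro i
      refine mem_range_algebraMap_of_pow_card_eq ?_
      exact congrFun (Matrix.vecMul_injective_iff_isUnit.2 hunit hfix) i
    choose y hy using hak
    have hsum : (⟨v, hv⟩ : fEigenvectors V c) = ∑ i, y i • e i := by
      apply Subtype.ext
      change v = _
      rw [← ha, hrow]
      simp only [e, Submodule.coe_sum, Submodule.coe_smul]
      refine Finset.sum_congr rfl fun i _ => ?_
      rw [← hy i, algebraMap_smul]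
    rw [hsum]
    exact Submodule.sum_mem _ fun i _ =>
      Submodule.smul_mem _ _ (Submodule.subset_span ⟨i, rfl⟩)
  refine ⟨Module.Basis.mk hek hes, fun i j => ?_⟩
  rw [Module.Basis.mk_apply]
  rfl

theorem iterate_twist_eq_self [Finite K] (h : G.frobenius^[r] c = c)
    (hs : s = orderOf (G.twistedProd c r)) (hK : Module.finrank k K = r * s)
    {M : Matrix (Fin d) (Fin d) K} (hM : M.map (algebraMap K (AlgebraicClosure k)) = (V.ρ c).1)
    (v : Fin d → K) : (twist k M)^[Module.finrank k K] v = v := by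
  funext i
  apply (algebraMap K (AlgebraicClosure k)).injective
  rw [map_iterate_twist, hM, iterate_twist_rho, hK, twistedProd_mul h, hs, pow_orderOf_eq_one,
    map_one, ← hs]
  simp only [Units.val_one, Matrix.vecMul_one, iterate_frob]
  rw [← hK, ← Module.natCard_eq_pow_finrank, algebraMap_pow_card]

end AlgebraicGroups

/-! ### Loops, frame conditions, and `q`-th powers by repeated squaring. -/

section Programs

/-- The natural number variable stored in the cell `(0, 0)` of an array. -/
abbrev natVar (a : ℕ) : IExpr := .cell a (.lit 0) (.lit 0)

/-- The cell `(0, 0)` of an array. -/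
abbrev scalar (a : ℕ) : Ref := ⟨a, .lit 0, .lit 0⟩

/-- The number `q` of elements of the base field. -/
abbrev qExpr : IExpr := .cell 0 (.lit 0) (.lit 0)

/-- The dimension `d` of the module. -/
abbrev dimExpr : IExpr := .cell 0 (.lit 1) (.lit 0)

/-- For the variable `c` from `0` to `N - 1` do `body`. -/
def forLoop (c : ℕ) (N : IExpr) (body : Cmd) : Cmd :=
  .seq (.natSet (scalar c) (.lit 0))
    (.loop (.lt (natVar c) N) (.seq body (.natSet (scalar c) (.add (natVar c) (.lit 1)))))

theorem Mem.set_self {α : Type*} (m : Mem α) (a i j : ℕ) (v : α) (i' j' : ℕ) :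
    m.set a i j v a i' j' = if i' = i ∧ j' = j then v else m a i' j' := by
  simp [Mem.set]

/-- Array numbers keep the program variables apart. Natural numbers: `0` input, `1` degree `n`, `2`
and `3` outer counters, `4` number of stored rows, `6` to `8` inner counters, `9` to `11` powering.
Elements of `K`: `0` input matrix, `1` output, `2` generator and its current power, `3` triangular
matrix, `4` trace, `5` current vector, `6` work row, `7` to `10` scratch. -/
theorem Mem.set_of_ne {α : Type*} (m : Mem α) {a b : ℕ} (h : b ≠ a) (i j : ℕ) (v : α) :
    m.set a i j v b = m b := by
  funext i' j'
  simp [Mem.set, h]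

variable {k K : Type*}

/-- At most the arrays of natural numbers in `S` and the arrays of elements of the extension
field in `U` change. -/
structure Mod (S U : List ℕ) (σ τ : State k K) : Prop where
  nat : ∀ a ∉ S, τ.nat a = σ.nat a
  ext : ∀ a ∉ U, τ.ext a = σ.ext a

namespace Mod

variable {S S' U U' : List ℕ} {σ τ υ : State k K}

theorem refl : Mod S U σ σ := ⟨fun _ _ => rfl, fun _ _ => rfl⟩

theorem mono (h : Mod S U σ τ) (hS : S ⊆ S') (hU : U ⊆ U') : Mod S' U' σ τ :=
  ⟨fun a ha => h.nat a fun h' => ha (hS h'), fun a ha => h.ext a fun h' => ha (hU h')⟩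

theorem trans (h : Mod S U σ τ) (h' : Mod S U τ υ) : Mod S U σ υ :=
  ⟨fun a ha => (h'.nat a ha).trans (h.nat a ha), fun a ha => (h'.ext a ha).trans (h.ext a ha)⟩

theorem set_nat (h : Mod S U σ τ) {c : ℕ} (hc : c ∈ S) (i j v : ℕ) :
    Mod S U σ { τ with nat := τ.nat.set c i j v } :=
  ⟨fun a ha => (Mem.set_of_ne _ (by rintro rfl; exact ha hc) _ _ _).trans (h.nat a ha), h.ext⟩

theorem set_ext (h : Mod S U σ τ) {c : ℕ} (hc : c ∈ U) (i j : ℕ) (v : K) :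
    Mod S U σ { τ with ext := τ.ext.set c i j v } :=
  ⟨h.nat, fun a ha => (Mem.set_of_ne _ (by rintro rfl; exact ha hc) _ _ _).trans (h.ext a ha)⟩

end Mod

variable [Field k] [Field K] [Algebra k K] {pb : PowerBasis k K}

theorem one_le_opCost (K : Type*) [Field K] [Finite K] : 1 ≤ opCost K :=
  Nat.clog_pos one_lt_two Finite.one_lt_card

theorem Trip.forLoop {c n T : ℕ} {N : IExpr} {body : Cmd} {σ : State k K} (hc : N.cost ≤ 3)
    (I : ℕ → State k K → Prop)
    (hI : ∀ i τ v, I i τ → I i { τ with nat := τ.nat.set c 0 0 v }) (h0 : I 0 σ)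
    (hN : ∀ i τ, I i τ → N.eval τ.nat = n)
    (hbody : ∀ i < n, ∀ τ, I i τ → τ.nat c 0 0 = i →
      Trip pb body τ T fun υ => υ.nat c 0 0 = i ∧ I (i + 1) υ) :
    Trip pb (forLoop c N body) σ (n * (T + 16) + 12) (I n) := by
  have hloop : Trip pb (.loop (.lt (natVar c) N)
      (.seq body (.natSet (scalar c) (.add (natVar c) (.lit 1)))))
      { σ with nat := σ.nat.set c 0 0 0 }
      (n * (T + 8 + 1 + (Test.lt (natVar c) N).cost k K) + (Test.lt (natVar c) N).cost k K)
      (fun τ => τ.nat c 0 0 = n ∧ I n τ) := by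
    refine Trip.loop (fun i τ => τ.nat c 0 0 = i ∧ I i τ) ?_ ?_ ?_
    · exact ⟨by simp [Mem.set_self], hI _ _ _ h0⟩
    · rintro τ ⟨h1, h2⟩
      simp [Test.eval, IExpr.eval, h1, hN _ _ h2]
    · rintro i hi τ ⟨h1, h2⟩
      refine ⟨by simp [Test.eval, IExpr.eval, h1, hN _ _ h2, hi], ?_⟩
      refine Trip.seq ((hbody i hi τ h2 h1).imp ?_)
      rintro υ ⟨h3, h4⟩
      refine Trip.mono (T₁ := (scalar c).cost + (IExpr.add (natVar c) (.lit 1)).cost)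
        (by simp [Ref.cost, IExpr.cost]) (Trip.natSet ⟨?_, ?_⟩)
      · simp [Ref.set, IExpr.eval, Mem.set_self, h3]
      · exact hI _ _ _ h4
  have h := Trip.seq (a := .natSet (scalar c) (.lit 0)) (Trip.natSet (σ := σ) hloop)
  refine h.conseq ?_ fun τ hτ => hτ.2
  -- Per pass `16 = 8 + 1 + 7` for increment, sequencing and test; once `12 = 4 + 1 + 7` for
  -- initialisation, sequencing and the last test.
  simp only [Test.cost, Ref.cost, IExpr.cost]
  have : n * (T + 8 + 1 + (1 + 1 + 1 + N.cost + 1)) ≤ n * (T + 16) :=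
    Nat.mul_le_mul_left _ (by omega)
  omega

/-- A loop, with counter in the array `7`, whose passes compute the coordinates of a row of the
array `A`. -/
theorem Trip.forRow {A ρ d T : ℕ} {body : Cmd} {σ : State k K} (S U : List ℕ) (g : ℕ → K)
    (hd : σ.nat 0 1 0 = d) (hS : 7 ∉ S ∧ 0 ∉ S)
    (hbody : ∀ i < d, ∀ τ, Mod (7 :: S) (A :: U) σ τ → τ.nat 7 0 0 = i →
      (∀ x j, τ.ext A x j = if x = ρ ∧ j < i then g j else σ.ext A x j) →
      Trip pb body τ T fun υ => Mod S (A :: U) τ υ ∧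
        ∀ x j, υ.ext A x j = if x = ρ ∧ j = i then g i else τ.ext A x j) :
    Trip pb (LangAlg.forLoop 7 dimExpr body) σ (d * (T + 16) + 12) fun τ =>
      Mod (7 :: S) (A :: U) σ τ ∧
        ∀ x j, τ.ext A x j = if x = ρ ∧ j < d then g j else σ.ext A x j := by
  refine Trip.forLoop (by simp [IExpr.cost]) (fun i τ => Mod (7 :: S) (A :: U) σ τ ∧
        ∀ x j, τ.ext A x j = if x = ρ ∧ j < i then g j else σ.ext A x j) ?_ ?_ ?_ ?_
  · rintro i τ v ⟨h1, h2⟩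
    exact ⟨h1.set_nat (by simp) _ _ _, h2⟩
  · exact ⟨Mod.refl, by simp⟩
  · rintro i τ ⟨h1, -⟩
    simp [IExpr.eval, h1.nat 0 (by simp [hS.2]), hd]
  · rintro i hi τ ⟨h1, h2⟩ h3
    refine (hbody i hi τ h1 h3 h2).imp ?_
    rintro υ ⟨h4, h5⟩
    refine ⟨by rw [h4.nat 7 hS.1, h3], h1.trans (h4.mono (by simp) (by simp)), ?_⟩
    intro x j
    rw [h5, h2]
    by_cases hx : x = ρ
    · by_cases hj : j = i
      · simp [hx, hj]
      · have : j < i + 1 ↔ j < i := by omega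
        simp [hj, this]
    · simp [hx]

/-- While `2 ^ i ≤ q`, the numbers `2 ^ i` are put into the array `10`, and the powers with these
exponents of the element in the cell `(0, 0)` of the array `7` into the array `8`. -/
def powUpBody : Cmd :=
  .seq (.natSet ⟨10, .lit 0, .add (natVar 9) (.lit 1)⟩
    (.add (.cell 10 (.lit 0) (natVar 9)) (.cell 10 (.lit 0) (natVar 9)))) <|
  .seq (.extOp ⟨8, .lit 0, .add (natVar 9) (.lit 1)⟩
    (.mul ⟨8, .lit 0, natVar 9⟩ ⟨8, .lit 0, natVar 9⟩))
  (.natSet (scalar 9) (.add (natVar 9) (.lit 1)))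

/-- One binary digit of `q` is removed from the remaining exponent in the array `11`. -/
def powDownBody : Cmd :=
  .seq (.natSet (scalar 9) (.sub (natVar 9) (.lit 1))) <|
  .branch (.lt (.cell 10 (.lit 0) (natVar 9)) (.add (natVar 11) (.lit 1)))
    (.seq (.natSet (scalar 11) (.sub (natVar 11) (.cell 10 (.lit 0) (natVar 9))))
      (.extOp (scalar 9) (.mul (scalar 9) ⟨8, .lit 0, natVar 9⟩)))
    .skip

/-- The power of the element in the cell `(0, 0)` of the array `7` with exponent `q` is put into
the cell `(0, 0)` of the array `9`. -/
def powCmd : Cmd :=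
  .seq (.natSet (scalar 9) (.lit 0)) <|
  .seq (.natSet (scalar 10) (.lit 1)) <|
  .seq (.extOp (scalar 8) (.copy (scalar 7))) <|
  .seq (.loop (.lt (.cell 10 (.lit 0) (natVar 9)) (.add qExpr (.lit 1))) powUpBody) <|
  .seq (.natSet (scalar 11) qExpr) <|
  .seq (.extOp (scalar 9) .one) <|
  .loop (.lt (.lit 0) (natVar 9)) powDownBody

theorem clog_two_succ_le {q : ℕ} (hq : 2 ≤ q) : Nat.clog 2 (q + 1) ≤ 2 * Nat.clog 2 q := by
  have h1 : 1 ≤ Nat.clog 2 q := Nat.clog_pos one_lt_two hq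
  refine Nat.clog_le_of_le_pow ?_
  have h2 : q ≤ 2 ^ Nat.clog 2 q := Nat.le_pow_clog one_lt_two q
  calc q + 1 ≤ 2 ^ Nat.clog 2 q * 2 := by omega
    _ = 2 ^ (Nat.clog 2 q + 1) := (pow_succ _ _).symm
    _ ≤ 2 ^ (2 * Nat.clog 2 q) := Nat.pow_le_pow_right two_pos (by omega)

/-- The arrays `10` and `8` contain the powers of `2` and of `x` up to the index `t`. -/
def PowTable (x : K) (t : ℕ) (τ : State k K) : Prop :=
  ∀ j ≤ t, τ.nat 10 0 j = 2 ^ j ∧ τ.ext 8 0 j = x ^ 2 ^ j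

variable [Finite K]

theorem trip_powUpBody {x : K} {i : ℕ} {τ : State k K} (h2 : τ.nat 9 0 0 = i)
    (h3 : PowTable x i τ) :
    Trip pb powUpBody τ (60 * opCost K) fun υ =>
      Mod [9, 10] [8] τ υ ∧ υ.nat 9 0 0 = i + 1 ∧ PowTable x (i + 1) υ := by
  refine Trip.mono ?_ (.seq (.natSet (.seq (.extOp (.natSet ⟨?_, ?_, ?_⟩)))))
  · have h1 : 1 ≤ opCost K := one_le_opCost K
    simp only [Ref.cost, IExpr.cost, FieldOp.cost]
    omega
  · exact ((Mod.refl.set_nat (by simp) _ _ _).set_ext (by simp) _ _ _).set_nat (by simp) _ _ _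
  · simp [Ref.set, IExpr.eval, Mem.set_self, Mem.set_of_ne, h2]
  · intro j hj
    rcases Nat.lt_or_ge i j with hij | hij
    · obtain rfl : j = i + 1 := by omega
      simp [Ref.set, Ref.get, IExpr.eval, FieldOp.eval, Mem.set_self, Mem.set_of_ne, h2,
        h3 i le_rfl, pow_succ, pow_mul]
      ring
    · have hne : j ≠ i + 1 := by omega
      simp [Ref.set, Ref.get, IExpr.eval, FieldOp.eval, Mem.set_self, Mem.set_of_ne, h2,
        h3 j hij, hne]

/-- Natural numbers cannot be halved, so binary digits are read greedily from the top, with the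
tabulated powers of `2`. Invariant: accumulator times `x` to the remaining exponent is the wanted
power, and that exponent is below the last power of `2` tried. -/
theorem trip_powDownBody {x y : K} {i t : ℕ} {τ : State k K} (hi : i < t)
    (h2 : τ.nat 9 0 0 = t - i) (h3 : PowTable x t τ) (h4 : τ.nat 11 0 0 < 2 ^ (t - i))
    (h5 : τ.ext 9 0 0 * x ^ (τ.nat 11 0 0) = y) :
    Trip pb powDownBody τ (60 * opCost K) fun υ =>
      Mod [9, 11] [9] τ υ ∧ υ.nat 9 0 0 = t - (i + 1) ∧ PowTable x t υ
        ∧ υ.nat 11 0 0 < 2 ^ (t - (i + 1)) ∧ υ.ext 9 0 0 * x ^ (υ.nat 11 0 0) = y := by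
  have h1 : 1 ≤ opCost K := one_le_opCost K
  have hp : t - i = t - (i + 1) + 1 := by omega
  have h3' := h3 (t - (i + 1)) (by omega)
  rw [hp, pow_succ] at h4
  have hm : t - i - 1 = t - (i + 1) := by omega
  refine Trip.mono ?_ (.seq (.natSet (.branch (T := 40 * opCost K)
    (fun htest => Trip.mono ?_ (.seq (.natSet (.extOp ?_))))
    (fun htest => Trip.mono (by omega) (.skip ?_)))))
  · simp only [Ref.cost, IExpr.cost, Test.cost]
    omega
  · simp only [Ref.cost, IExpr.cost, FieldOp.cost]
    omega
  · simp [Test.eval, Ref.set, IExpr.eval, Mem.set_self, Mem.set_of_ne, h2, hm, h3'] at htest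
    refine ⟨((Mod.refl.set_nat (by simp) _ _ _).set_nat (by simp) _ _ _).set_ext (by simp) _ _ _,
      ?_, ?_, ?_, ?_⟩
    · simp [Ref.set, IExpr.eval, Mem.set_self, Mem.set_of_ne, h2, hm]
    · simpa [PowTable, Ref.set, IExpr.eval, Mem.set_of_ne] using h3
    · simp [Ref.set, IExpr.eval, Mem.set_self, Mem.set_of_ne, h2, hm, h3']
      omega
    · simp [Ref.set, Ref.get, IExpr.eval, FieldOp.eval, Mem.set_self, Mem.set_of_ne, h2, hm, h3']
      rw [mul_assoc, ← pow_add, ← h5]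
      congr 2
      omega
  · simp [Test.eval, Ref.set, IExpr.eval, Mem.set_self, Mem.set_of_ne, h2, hm, h3'] at htest
    refine ⟨Mod.refl.set_nat (by simp) _ _ _, ?_, ?_, ?_, ?_⟩
    · simp [Ref.set, IExpr.eval, Mem.set_self, h2, hm]
    · simpa [PowTable, Ref.set, IExpr.eval, Mem.set_of_ne] using h3
    · simp [Ref.set, IExpr.eval, Mem.set_of_ne]
      omega
    · simpa [Ref.set, IExpr.eval, Mem.set_of_ne] using h5

theorem trip_powCmd {q : ℕ} {σ : State k K} (hq : 2 ≤ q) (hσ : σ.nat 0 0 0 = q) :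
    Trip pb powCmd σ (500 * (Nat.clog 2 q * opCost K)) fun τ =>
      Mod [9, 10, 11] [8, 9] σ τ ∧ τ.ext 9 0 0 = σ.ext 7 0 0 ^ q := by
  set x := σ.ext 7 0 0 with hx
  -- The number of binary digits of `q`; both loops make exactly `t` passes. It is at most `2 *
  -- Nat.clog 2 q`.
  set t := Nat.clog 2 (q + 1) with ht
  have hqt : q + 1 ≤ 2 ^ t := Nat.le_pow_clog one_lt_two (q + 1)
  have hκ : 1 ≤ opCost K := one_le_opCost K
  refine Trip.mono ?_ (.seq (.natSet (.seq (.natSet (.seq (.extOp (.seq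
    (T₂ := t * (80 * opCost K) + 60 * opCost K) ((Trip.loop (N := t) (T := 60 * opCost K)
      (fun i τ => Mod [9, 10] [8] σ τ ∧ τ.nat 9 0 0 = i ∧ PowTable x i τ)
      ?_ ?_ ?_).imp ?_))))))))
  · have h1 : t * (80 * opCost K) ≤ 2 * Nat.clog 2 q * (80 * opCost K) :=
      Nat.mul_le_mul_right _ (clog_two_succ_le hq)
    have h2 : 1 * opCost K ≤ Nat.clog 2 q * opCost K :=
      Nat.mul_le_mul_right _ (Nat.clog_pos one_lt_two hq)
    have h3 : t * (60 * opCost K + 20) ≤ t * (80 * opCost K) := Nat.mul_le_mul_left _ (by omega)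
    simp only [Ref.cost, IExpr.cost, FieldOp.cost, Test.cost]
    nlinarith
  · refine ⟨((Mod.refl.set_nat (by simp) _ _ _).set_nat (by simp) _ _ _).set_ext (by simp) _ _ _,
      ?_, ?_⟩
    · simp [Ref.set, IExpr.eval, Mem.set_self, Mem.set_of_ne]
    · intro j hj
      obtain rfl : j = 0 := by omega
      simp [Ref.set, Ref.get, FieldOp.eval, IExpr.eval, Mem.set_self, x]
  · rintro τ ⟨h1, h2, h3⟩
    simp [Test.eval, IExpr.eval, h2, (h3 t le_rfl).1, h1.nat 0 (by simp), hσ]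
    omega
  · rintro i hi τ ⟨h1, h2, h3⟩
    have hlt : 2 ^ i < q + 1 := by
      by_contra hcon
      have := Nat.clog_le_of_le_pow (b := 2) (not_lt.1 hcon)
      omega
    refine ⟨by simp [Test.eval, IExpr.eval, h2, (h3 i le_rfl).1, h1.nat 0 (by simp), hσ]; omega,
      (trip_powUpBody h2 h3).imp fun υ hυ => ⟨h1.trans hυ.1, hυ.2⟩⟩
  · rintro τ ⟨h1, h2, h3⟩
    refine Trip.mono ?_ (.seq (.natSet (.seq (.extOp ((Trip.loop (N := t) (T := 60 * opCost K)
      (fun i τ => Mod [9, 10, 11] [8, 9] σ τ ∧ τ.nat 9 0 0 = t - i ∧ PowTable x t τ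
        ∧ τ.nat 11 0 0 < 2 ^ (t - i) ∧ τ.ext 9 0 0 * x ^ (τ.nat 11 0 0) = x ^ q)
      ?_ ?_ ?_).imp ?_)))))
    · have h3 : t * (60 * opCost K + 20) ≤ t * (80 * opCost K) := Nat.mul_le_mul_left _ (by omega)
      simp only [Ref.cost, IExpr.cost, FieldOp.cost, Test.cost]
      nlinarith
    · refine ⟨(((h1.mono (by simp) (by simp)).set_nat (by simp) _ _ _).set_ext (by simp) _ _ _),
        ?_, ?_, ?_, ?_⟩
      · simp [Ref.set, IExpr.eval, Mem.set_of_ne, h2]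
      · simpa [PowTable, Ref.set, IExpr.eval, Mem.set_of_ne] using h3
      · simp [Ref.set, IExpr.eval, Mem.set_self, h1.nat 0 (by simp), hσ]
        omega
      · simp [Ref.set, IExpr.eval, FieldOp.eval, Mem.set_self, h1.nat 0 (by simp), hσ]
    · rintro υ ⟨h1, h2, -⟩
      simp [Test.eval, IExpr.eval, h2]
    · rintro i hi υ ⟨h1, h2, h3, h4, h5⟩
      refine ⟨by simp [Test.eval, IExpr.eval, h2]; omega,
        (trip_powDownBody hi h2 h3 h4 h5).imp fun ω hω =>
          ⟨h1.trans (hω.1.mono (by simp) (by simp)), hω.2⟩⟩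
    · rintro υ ⟨h4, h5, h6, h7, h8⟩
      have : υ.nat 11 0 0 = 0 := by simpa using h7
      exact ⟨h4, by simpa [this] using h8⟩

end Programs

/-! ### Computing one twisted trace. -/

section TraceProgram

/-- The `q`-th powers of the coordinates of the row in the array `5` are put into the array `6`. -/
def frobRowCmd : Cmd :=
  forLoop 7 dimExpr <|
    .seq (.extOp (scalar 7) (.copy ⟨5, .lit 0, natVar 7⟩)) <|
    .seq powCmd (.extOp ⟨6, .lit 0, natVar 7⟩ (.copy (scalar 9)))

/-- The product of the row in the array `6` with column `natVar 7` of the input matrix is put into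
the cell `(0, 0)` of the array `7`. -/
def dotCmd : Cmd :=
  .seq (.extOp (scalar 7) .zero) <|
    forLoop 8 dimExpr <|
      .seq (.extOp (scalar 10) (.mul ⟨6, .lit 0, natVar 8⟩ ⟨0, natVar 8, natVar 7⟩))
        (.extOp (scalar 7) (.add (scalar 7) (scalar 10)))

/-- The product of the row in the array `6` with the input matrix is put into the array `5`. -/
def mulRowCmd : Cmd :=
  forLoop 7 dimExpr <| .seq dotCmd (.extOp ⟨5, .lit 0, natVar 7⟩ (.copy (scalar 7)))

/-- The row in the array `5` is added to the row in the array `4`. -/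
def addRowCmd : Cmd :=
  forLoop 7 dimExpr <|
    .extOp ⟨4, .lit 0, natVar 7⟩ (.add ⟨4, .lit 0, natVar 7⟩ ⟨5, .lit 0, natVar 7⟩)

/-- The twisted trace of the row in the array `5` is put into the array `4`. -/
def traceCmd : Cmd :=
  .seq (forLoop 7 dimExpr <| .extOp ⟨4, .lit 0, natVar 7⟩ .zero) <|
    forLoop 6 (natVar 1) <| .seq addRowCmd <| .seq frobRowCmd mulRowCmd

/-- Because `d ≥ 1`, the constant `12` of a loop is spread over its passes, and `28 = 16 + 12`. -/
theorem row_cost_le {d T B C : ℕ} (hd : 1 ≤ d) (h : T + 28 ≤ C * B) :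
    d * (T + 16) + 12 ≤ C * (d * B) :=
  calc d * (T + 16) + 12 ≤ d * (T + 28) := by linarith
    _ ≤ d * (C * B) := Nat.mul_le_mul_left d h
    _ = C * (d * B) := by ring

/-- The vector in a row of an array. -/
def State.row {k K : Type*} (σ : State k K) (d A ρ : ℕ) : Fin d → K := fun j => σ.ext A ρ j

/-- The memory contains the input of the algorithm and the degree `n` of the extension. -/
structure HasInput {k K : Type*} (q n : ℕ) {d : ℕ} (M : Matrix (Fin d) (Fin d) K)
    (σ : State k K) : Prop where
  card : σ.nat 0 0 0 = q
  dim : σ.nat 0 1 0 = d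
  deg : σ.nat 1 0 0 = n
  mat : ∀ i j : Fin d, σ.ext 0 i j = M i j

theorem HasInput.of_mod {k K : Type*} {q n d : ℕ} {M : Matrix (Fin d) (Fin d) K}
    {σ τ : State k K} {S U : List ℕ} (h : HasInput q n M σ) (hm : Mod S U σ τ)
    (hS : 0 ∉ S ∧ 1 ∉ S) (hU : 0 ∉ U) : HasInput q n M τ :=
  ⟨by rw [hm.nat 0 hS.1, h.card], by rw [hm.nat 0 hS.1, h.dim], by rw [hm.nat 1 hS.2, h.deg],
    fun i j => by rw [hm.ext 0 hU, h.mat]⟩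

variable {k K : Type*} [Field k] [Field K] [Algebra k K] {pb : PowerBasis k K} [Finite K]
  {q n d : ℕ} {M : Matrix (Fin d) (Fin d) K} {σ : State k K}

theorem trip_frobRowCmd (hq : 2 ≤ q) (hd : 1 ≤ d) (h : HasInput q n M σ) :
    Trip pb frobRowCmd σ (600 * (d * (Nat.clog 2 q * opCost K))) fun τ =>
      Mod [7, 9, 10, 11] [6, 7, 8, 9] σ τ ∧ τ.row d 6 0 = fun j => σ.row d 5 0 j ^ q := by
  have hκ : 1 ≤ opCost K := one_le_opCost K
  have hL : 1 ≤ Nat.clog 2 q := Nat.clog_pos one_lt_two hq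
  have hLκ : 1 * opCost K ≤ Nat.clog 2 q * opCost K := Nat.mul_le_mul_right _ hL
  refine (Trip.forRow (A := 6) (ρ := 0) (T := 550 * (Nat.clog 2 q * opCost K)) (d := d)
    [9, 10, 11] [7, 8, 9] (fun j => σ.ext 5 0 j ^ q) h.dim (by simp) ?_).conseq ?_ ?_
  · intro i hi τ h1 h2 h3
    refine Trip.mono ?_ (.seq (.extOp (.seq (T₂ := 20 * opCost K)
      ((trip_powCmd (q := q) hq ?_).imp ?_))))
    rotate_left
    · exact (h1.nat 0 (by simp)).symm ▸ h.card
    · rintro υ ⟨h4, h5⟩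
      refine Trip.mono ?_ (.extOp ⟨?_, ?_⟩)
      · simp only [Ref.cost, IExpr.cost, FieldOp.cost]
        omega
      · refine Mod.set_ext ?_ (by simp) _ _ _
        exact (Mod.refl.set_ext (by simp) _ _ _).trans (h4.mono (by simp) (by simp))
      · intro x j
        have h6 := h4.nat 7 (by simp)
        have h7 := h4.ext 6 (by simp)
        have h8 := h1.ext 5 (by simp)
        simp [Ref.set, Ref.get, IExpr.eval, FieldOp.eval, Mem.set_self, Mem.set_of_ne, h5, h6, h7,
          h8, h2]
    · simp only [Ref.cost, IExpr.cost, FieldOp.cost]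
      omega
  · exact row_cost_le hd (by omega)
  · rintro τ ⟨h1, h2⟩
    refine ⟨h1.mono (by simp) (by simp), ?_⟩
    funext j
    simp [State.row, h2]

theorem trip_dotCmd (hd : 1 ≤ d) (h : HasInput q n M σ) (a : Fin d) (ha : σ.nat 7 0 0 = a) :
    Trip pb dotCmd σ (70 * (d * opCost K)) fun τ =>
      Mod [8] [7, 10] σ τ ∧ τ.ext 7 0 0 = Matrix.vecMul (σ.row d 6 0) M a := by
  have hκ : 1 ≤ opCost K := one_le_opCost K
  set g : ℕ → K := fun b => σ.ext 6 0 b * σ.ext 0 b a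
  refine Trip.mono ?_ (.seq (.extOp ((Trip.forLoop (n := d) (T := 35 * opCost K)
    (by simp [IExpr.cost]) (fun i τ => Mod [8] [7, 10] σ τ
      ∧ τ.ext 7 0 0 = ∑ b ∈ Finset.range i, g b) ?_ ?_ ?_ ?_).imp ?_)))
  · have h1 : d * 1 ≤ d * opCost K := Nat.mul_le_mul_left _ hκ
    have h2 : 1 * opCost K ≤ d * opCost K := Nat.mul_le_mul_right _ hd
    have h3 : d * (35 * opCost K + 16) = 35 * (d * opCost K) + 16 * d := by ring
    simp only [Ref.cost, IExpr.cost, FieldOp.cost]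
    omega
  · rintro i τ v ⟨h1, h2⟩
    exact ⟨h1.set_nat (by simp) _ _ _, h2⟩
  · refine ⟨Mod.refl.set_ext (by simp) _ _ _, ?_⟩
    simp [Ref.set, IExpr.eval, FieldOp.eval, Mem.set_self]
  · rintro i τ ⟨h1, -⟩
    simp [IExpr.eval, h1.nat 0 (by simp), h.dim]
  · rintro i hi τ ⟨h1, h2⟩ h3
    refine Trip.mono ?_ (.seq (.extOp (.extOp ⟨?_, ?_, ?_⟩)))
    · simp only [Ref.cost, IExpr.cost, FieldOp.cost]
      omega
    · exact h3
    · exact (h1.set_ext (by simp) _ _ _).set_ext (by simp) _ _ _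
    · simp [Ref.set, Ref.get, IExpr.eval, FieldOp.eval, Mem.set_self, Mem.set_of_ne, h2, h3,
        h1.nat 7 (by simp), h1.ext 6 (by simp), h1.ext 0 (by simp), ha, Finset.sum_range_succ, g]
  · rintro τ ⟨h1, h2⟩
    refine ⟨h1, ?_⟩
    rw [h2, Finset.sum_range]
    simp only [Matrix.vecMul, dotProduct, State.row, g, h.mat]

theorem trip_mulRowCmd (hd : 1 ≤ d) (h : HasInput q n M σ) :
    Trip pb mulRowCmd σ (150 * (d * d * opCost K)) fun τ =>
      Mod [7, 8] [5, 7, 10] σ τ ∧ τ.row d 5 0 = Matrix.vecMul (σ.row d 6 0) M := by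
  have hκ : 1 ≤ opCost K := one_le_opCost K
  have hdκ : 1 * opCost K ≤ d * opCost K := Nat.mul_le_mul_right _ hd
  refine (Trip.forRow (A := 5) (ρ := 0) (T := 95 * (d * opCost K)) (d := d) [8] [7, 10]
    (fun j => if hj : j < d then Matrix.vecMul (σ.row d 6 0) M ⟨j, hj⟩ else 0) h.dim (by simp)
    ?_).conseq ?_ ?_
  · intro i hi τ h1 h2 h3
    refine Trip.mono ?_ (.seq (T₂ := 20 * opCost K)
      ((trip_dotCmd hd (h.of_mod h1 (by simp) (by simp)) ⟨i, hi⟩ h2).imp ?_))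
    rotate_left
    · rintro υ ⟨h4, h5⟩
      refine Trip.mono ?_ (.extOp ⟨(h4.mono (by simp) (by simp)).set_ext (by simp) _ _ _, ?_⟩)
      · simp only [Ref.cost, IExpr.cost, FieldOp.cost]
        omega
      intro x j
      have h6 := h4.nat 7 (by simp)
      have h7 := h4.ext 5 (by simp)
      have h8 : τ.row d 6 0 = σ.row d 6 0 := by
        funext j
        simp only [State.row, h1.ext 6 (by simp)]
      rw [h8] at h5
      simp [Ref.set, Ref.get, IExpr.eval, FieldOp.eval, Mem.set_self, h5, h6, h7, h2, hi]
    · omega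
  · rw [mul_assoc]
    exact row_cost_le hd (by omega)
  · rintro τ ⟨h1, h2⟩
    refine ⟨h1.mono (by simp) (by simp), ?_⟩
    funext j
    simp [State.row, h2]

theorem trip_addRowCmd (hd : 1 ≤ d) (h : HasInput q n M σ) :
    Trip pb addRowCmd σ (60 * (d * opCost K)) fun τ =>
      Mod [7] [4] σ τ ∧ τ.row d 4 0 = σ.row d 4 0 + σ.row d 5 0 := by
  have hκ : 1 ≤ opCost K := one_le_opCost K
  refine (Trip.forRow (A := 4) (ρ := 0) (T := 30 * opCost K) (d := d) [] []
    (fun j => σ.ext 4 0 j + σ.ext 5 0 j) h.dim (by simp) ?_).conseq ?_ ?_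
  · intro i hi τ h1 h2 h3
    refine Trip.mono ?_ (.extOp ⟨Mod.refl.set_ext (by simp) _ _ _, ?_⟩)
    · simp only [Ref.cost, IExpr.cost, FieldOp.cost]
      omega
    · intro x j
      simp [Ref.set, Ref.get, IExpr.eval, FieldOp.eval, Mem.set_self, h2, h3, h1.ext 5 (by simp)]
  · exact row_cost_le hd (by omega)
  · rintro τ ⟨h1, h2⟩
    refine ⟨h1, ?_⟩
    funext j
    simp [State.row, h2]

theorem trip_traceCmd (hq : 2 ≤ q) (hd : 1 ≤ d) (hn : 1 ≤ n) (hk : q = Nat.card k)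
    (h : HasInput q n M σ) :
    Trip pb traceCmd σ (1000 * (n * (d * d * (Nat.clog 2 q * opCost K)))) fun τ =>
      Mod [6, 7, 8, 9, 10, 11] [4, 5, 6, 7, 8, 9, 10] σ τ
        ∧ τ.row d 4 0 = twistedTrace k M n (σ.row d 5 0) := by
  have hκ : 1 ≤ opCost K := one_le_opCost K
  have hL : 1 ≤ Nat.clog 2 q := Nat.clog_pos one_lt_two hq
  have hLκ : 1 * opCost K ≤ Nat.clog 2 q * opCost K := Nat.mul_le_mul_right _ hL
  have hd2 : d * 1 ≤ d * d := Nat.mul_le_mul_left _ hd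
  have hB1 : d * opCost K ≤ d * d * (Nat.clog 2 q * opCost K) := Nat.mul_le_mul (by omega) (by omega)
  have hB2 : d * (Nat.clog 2 q * opCost K) ≤ d * d * (Nat.clog 2 q * opCost K) := Nat.mul_le_mul_right _ (by omega)
  have hB3 : d * d * opCost K ≤ d * d * (Nat.clog 2 q * opCost K) := Nat.mul_le_mul_left _ (by omega)
  have hB4 : 1 * opCost K ≤ d * opCost K := Nat.mul_le_mul_right _ hd
  have hB5 : d * 1 ≤ d * opCost K := Nat.mul_le_mul_left _ hκ
  -- A common bound for the `d` powers, at `log q` multiplications each, and for the `d²`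
  -- multiplications of the vector-matrix product.
  set Z := d * d * (Nat.clog 2 q * opCost K) with hZ
  have hB6 : 1 * Z ≤ n * Z := Nat.mul_le_mul_right _ hn
  have hzero : Trip pb (forLoop 7 dimExpr <| .extOp ⟨4, .lit 0, natVar 7⟩ .zero) σ (70 * Z)
      fun τ => Mod [7] [4] σ τ ∧ τ.row d 4 0 = 0 := by
    refine (Trip.forRow (A := 4) (ρ := 0) (T := 20 * opCost K) (d := d) [] [] (fun _ => 0) h.dim (by simp)
      ?_).conseq ?_ ?_
    · intro i hi τ h1 h2 h3
      refine Trip.mono ?_ (.extOp ⟨Mod.refl.set_ext (by simp) _ _ _, ?_⟩)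
      · simp only [Ref.cost, IExpr.cost, FieldOp.cost]
        omega
      · intro x j
        simp [Ref.set, IExpr.eval, FieldOp.eval, Mem.set_self, h2]
    · have h3 : d * (20 * opCost K + 16) = 20 * (d * opCost K) + 16 * d := by ring
      omega
    · rintro τ ⟨h1, h2⟩
      refine ⟨h1, ?_⟩
      funext j
      simp [State.row, h2]
  refine Trip.mono ?_ (.seq (T₂ := n * (820 * Z + 16) + 12) (hzero.imp ?_))
  rotate_left
  · rintro τ₀ ⟨h1, h2⟩
    have h5 : τ₀.row d 5 0 = σ.row d 5 0 := by
      funext j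
      simp only [State.row, h1.ext 5 (by simp)]
    -- After `l` passes array `5` holds the `l`-th iterate and array `4` the sum of the iterates
    -- before it. A pass costs `60 + 600 + 150` units `Z` for addition, powers and product; the rest
    -- is slack for sequencing.
    refine (Trip.forLoop (n := n) (T := 820 * Z) (by simp [IExpr.cost])
      (fun l τ => Mod [6, 7, 8, 9, 10, 11] [4, 5, 6, 7, 8, 9, 10] σ τ
        ∧ τ.row d 4 0 = twistedTrace k M l (σ.row d 5 0)
        ∧ τ.row d 5 0 = (twist k M)^[l] (σ.row d 5 0)) ?_ ?_ ?_ ?_).imp ?_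
    · rintro i τ v ⟨h3, h4⟩
      exact ⟨h3.set_nat (by simp) _ _ _, h4⟩
    · exact ⟨h1.mono (by simp) (by simp), by rw [h2]; simp [twistedTrace], h5⟩
    · rintro i τ ⟨h3, -⟩
      simp [IExpr.eval, h3.nat 1 (by simp), h.deg]
    · rintro i hi τ ⟨h3, h4, h6⟩ h7
      have hτ := h.of_mod h3 (by simp) (by simp)
      refine Trip.mono ?_ (.seq (T₂ := 755 * Z) ((trip_addRowCmd hd hτ).imp ?_))
      rotate_left
      · rintro τ₁ ⟨m1, e1⟩
        have hτ1 := hτ.of_mod m1 (by simp) (by simp)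
        refine Trip.mono ?_ (.seq (T₂ := 150 * (d * d * opCost K)) ((trip_frobRowCmd hq hd hτ1).imp ?_))
        · omega
        rintro τ₂ ⟨m2, e2⟩
        have hτ2 := hτ1.of_mod m2 (by simp) (by simp)
        refine (trip_mulRowCmd hd hτ2).imp ?_
        rintro τ₃ ⟨m3, e3⟩
        refine ⟨?_, ?_, ?_, ?_⟩
        · rw [m3.nat 6 (by simp), m2.nat 6 (by simp), m1.nat 6 (by simp), h7]
        · exact ((h3.trans (m1.mono (by simp) (by simp))).trans (m2.mono (by simp) (by simp))).trans
            (m3.mono (by simp) (by simp))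
        · have : τ₃.row d 4 0 = τ₁.row d 4 0 := by
            funext j
            simp only [State.row, m3.ext 4 (by simp), m2.ext 4 (by simp)]
          rw [this, e1, h4, h6, twistedTrace, twistedTrace, Finset.sum_range_succ]
        · have : τ₁.row d 5 0 = τ.row d 5 0 := by
            funext j
            simp only [State.row, m1.ext 5 (by simp)]
          rw [e3, e2, this, h6, Function.iterate_succ_apply', twist, hk]
      · omega
    · rintro τ ⟨h3, h4, -⟩
      exact ⟨h3, h4⟩
  · have h3 : n * (820 * Z + 16) = 820 * (n * Z) + 16 * n := by ring
    have h4 : n * 1 ≤ n * Z := Nat.mul_le_mul_left _ (by omega)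
    omega

end TraceProgram

/-! ### Incremental triangular form of a family of fixed vectors. -/

section Echelon

variable (k : Type*) {K : Type*} [Field K] {d : ℕ}

/-- An upper triangular matrix `E` whose nonzero rows span the same space as the first `m` rows of
`B`, where these rows of `B` are fixed by `twist`, and `m` is the number of nonzero rows of `E`,
each of which has a nonzero diagonal entry. -/
structure IsEchelon (M : Matrix (Fin d) (Fin d) K) (E : Fin d → Fin d → K) (B : ℕ → Fin d → K)
    (m : ℕ) : Prop where
  tri : ∀ p j, j < p → E p j = 0
  zero : ∀ p, E p p = 0 → E p = 0
  card : m = {p | E p p ≠ 0}.ncard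
  span : Submodule.span K (Set.range E) = Submodule.span K (B '' Set.Iio m)
  fixed : ∀ i < m, twist k M (B i) = B i

namespace IsEchelon

variable {k} {M : Matrix (Fin d) (Fin d) K} {E : Fin d → Fin d → K} {B : ℕ → Fin d → K} {m : ℕ}

/-- A zero diagonal entry means a zero row, so overwriting it loses nothing. -/
theorem range_le_span_update (h : IsEchelon k M E B m) {p : Fin d} (hp : E p p = 0)
    (R : Fin d → K) : Submodule.span K (Set.range E)
      ≤ Submodule.span K (Set.range (Function.update E p R)) := by
  rw [Submodule.span_le]
  rintro _ ⟨x, rfl⟩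
  by_cases hx : x = p
  · rw [hx, h.zero p hp]
    exact Submodule.zero_mem _
  · exact Submodule.subset_span ⟨x, by simp [hx]⟩

/-- The reduced vector `R` goes into the triangular matrix, but the trace `T` itself into the
output, since reduction over `K` destroys being fixed by `twist`. As `T - R` lies in the old span,
both choices enlarge it equally. A row is filed under its pivot column, so no permutation is needed.
-/
theorem insert (h : IsEchelon k M E B m) {p : Fin d} (hp : E p p = 0) {R T : Fin d → K}
    (hR : ∀ j < p, R j = 0) (hRp : R p ≠ 0) (hT : T - R ∈ Submodule.span K (Set.range E))
    (hfix : twist k M T = T) :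
    IsEchelon k M (Function.update E p R) (Function.update B m T) (m + 1) where
  tri x j hj := by
    by_cases hx : x = p
    · subst hx
      simpa using hR j hj
    · simpa [hx] using h.tri x j hj
  zero x hx0 := by
    by_cases hx : x = p
    · subst hx
      exact absurd (by simpa using hx0) hRp
    · rw [Function.update_of_ne hx] at hx0 ⊢
      exact h.zero x hx0
  card := by
    have hset : {x | Function.update E p R x x ≠ 0} = Insert.insert p {x | E x x ≠ 0} := by
      ext x
      by_cases hx : x = p
      · subst hx
        simp [hRp]
      · simp [hx]
    rw [hset, Set.ncard_insert_of_notMem (by simp [hp]) (Set.toFinite _), ← h.card]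
  span := by
    have himg : Function.update B m T '' Set.Iio (m + 1) = Insert.insert T (B '' Set.Iio m) := by
      ext v
      simp only [Set.mem_image, Set.mem_Iio, Set.mem_insert_iff]
      constructor
      · rintro ⟨i, hi, rfl⟩
        by_cases him : i = m
        · subst him
          simp
        · exact Or.inr ⟨i, by omega, by simp [him]⟩
      · rintro (rfl | ⟨i, hi, rfl⟩)
        · exact ⟨m, by omega, by simp⟩
        · exact ⟨i, by omega, by simp [hi.ne]⟩
    have hle := h.range_le_span_update hp R
    have hRmem : R ∈ Submodule.span K (Set.range (Function.update E p R)) :=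
      Submodule.subset_span ⟨p, by simp⟩
    rw [himg]
    apply le_antisymm
    · rw [Submodule.span_le]
      have hle' : Submodule.span K (Set.range E)
          ≤ Submodule.span K (Insert.insert T (B '' Set.Iio m)) := by
        rw [h.span]
        exact Submodule.span_mono (Set.subset_insert _ _)
      rintro _ ⟨x, rfl⟩
      by_cases hx : x = p
      · subst hx
        rw [Function.update_self, ← sub_sub_cancel T R]
        exact Submodule.sub_mem _ (Submodule.subset_span (Set.mem_insert _ _)) (hle' hT)
      · rw [Function.update_of_ne hx]
        exact hle' (Submodule.subset_span ⟨x, rfl⟩)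
    · rw [Submodule.span_le]
      rintro v (rfl | hv)
      · have := Submodule.add_mem _ (hle hT) hRmem
        rwa [sub_add_cancel] at this
      · exact hle (h.span ▸ Submodule.subset_span hv)
  fixed i hi := by
    by_cases him : i = m
    · subst him
      simpa using hfix
    · simpa [him] using h.fixed i (by omega)

theorem le (h : IsEchelon k M E B m) : m ≤ d := by
  rw [h.card]
  simpa [Nat.card_eq_fintype_card] using Set.ncard_le_card {p | E p p ≠ 0}

/-- With `d` nonzero diagonal entries the triangular determinant is nonzero. -/
theorem span_eq_top (h : IsEchelon k M E B d) : Submodule.span K (Set.range E) = ⊤ := by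
  have huniv : {p | E p p ≠ 0} = Set.univ :=
    Set.eq_of_subset_of_ncard_le (Set.subset_univ _) (by rw [← h.card]; simp) (Set.toFinite _)
  have hdet : (Matrix.of E).det = ∏ p, E p p :=
    Matrix.det_of_isUpperTriangular fun p j hj => h.tri p j hj
  have hunit : IsUnit (Matrix.of E) := by
    rw [Matrix.isUnit_iff_isUnit_det, hdet, isUnit_iff_ne_zero, Finset.prod_ne_zero_iff]
    intro p _
    have : p ∈ {p | E p p ≠ 0} := by
      rw [huniv]
      trivial
    exact this
  exact (Matrix.linearIndependent_rows_iff_isUnit.2 hunit).span_eq_top_of_card_eq_finrank' (by simp)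

theorem eq_of_span_eq_top (h : IsEchelon k M E B m)
    (hs : Submodule.span K (Set.range E) = ⊤) : m = d := by
  refine le_antisymm h.le ?_
  rw [h.span] at hs
  classical
  have h1 := finrank_span_finset_le_card (R := K) ((Finset.range m).image B)
  rw [Finset.coe_image, Finset.coe_range, Set.finrank, hs, finrank_top] at h1
  simp only [Module.finrank_fin_fun] at h1
  exact h1.trans (Finset.card_image_le.trans (by simp))

theorem empty : IsEchelon k M (fun _ _ => (0 : K)) B 0 where
  tri _ _ _ := rfl
  zero _ _ := rfl
  card := by simp
  span := by
    rw [Set.Iio_zero_eq_empty]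
    rw [Set.image_empty, Submodule.span_empty, Submodule.span_eq_bot]
    rintro _ ⟨x, rfl⟩
    rfl
  fixed _ h := absurd h (by simp)

end IsEchelon

end Echelon

/-! ### Reducing a trace against the stored rows. -/

section ReduceProgram

/-- The row in the array `6` is stored as a row of the matrix in the array `3`, and the row in the
array `4` as the next row of the output. -/
def insertCmd : Cmd :=
  .seq (forLoop 7 dimExpr <|
    .extOp ⟨3, natVar 6, natVar 7⟩ (.copy ⟨6, .lit 0, natVar 7⟩)) <|
  .seq (forLoop 7 dimExpr <|
    .extOp ⟨1, natVar 4, natVar 7⟩ (.copy ⟨4, .lit 0, natVar 7⟩)) <|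
  .natSet (scalar 4) (.add (natVar 4) (.lit 1))

/-- A multiple of row `natVar 6` of the matrix in the array `3` is subtracted from the row in the
array `6`. -/
def eliminateCmd : Cmd :=
  .seq (.extOp (scalar 7) (.inv ⟨3, natVar 6, natVar 6⟩)) <|
  .seq (.extOp (scalar 7) (.mul (scalar 7) ⟨6, .lit 0, natVar 6⟩)) <|
  forLoop 7 dimExpr <|
    .seq (.extOp (scalar 10) (.mul (scalar 7) ⟨3, natVar 6, natVar 7⟩))
      (.extOp ⟨6, .lit 0, natVar 7⟩ (.sub ⟨6, .lit 0, natVar 7⟩ (scalar 10)))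

/-- The row in the array `4` is reduced, and stored if it is not in the span of the rows that have
been stored before. -/
def reduceCmd : Cmd :=
  .seq (forLoop 7 dimExpr <| .extOp ⟨6, .lit 0, natVar 7⟩ (.copy ⟨4, .lit 0, natVar 7⟩)) <|
  forLoop 6 dimExpr <|
    .seq (.branch (.extIsZero ⟨6, .lit 0, natVar 6⟩) .skip <|
      .branch (.extIsZero ⟨3, natVar 6, natVar 6⟩) insertCmd .skip)
    eliminateCmd

/-- The twisted trace of the row in the array `5` is reduced, and stored if it is not in the span
of the rows that have been stored before. -/
def processCmd : Cmd := .seq traceCmd reduceCmd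

/-- The span of the rows of the matrix in the array `3`. -/
def State.rowSpan {k K : Type*} [Field K] (σ : State k K) (d : ℕ) : Submodule K (Fin d → K) :=
  Submodule.span K (Set.range fun p : Fin d => σ.row d 3 p)

/-- The arrays `3` and `1` and the variable `4` satisfy `IsEchelon`. -/
def State.IsReduced {k K : Type*} [Field K] {d : ℕ} (σ : State k K)
    (M : Matrix (Fin d) (Fin d) K) : Prop :=
  IsEchelon k M (fun p => σ.row d 3 p) (fun i => σ.row d 1 i) (σ.nat 4 0 0)

theorem State.row_of_mod {k K : Type*} {S U : List ℕ} {σ τ : State k K} (h : Mod S U σ τ)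
    {A : ℕ} (hA : A ∉ U) (d ρ : ℕ) : τ.row d A ρ = σ.row d A ρ := by
  funext j
  simp only [State.row, h.ext A hA]

variable {k K : Type*} [Field K] {d : ℕ} {M : Matrix (Fin d) (Fin d) K} {σ : State k K}

/-- The state after the first `i` passes of the loop of `reduceCmd`. -/
structure ReduceInv (M : Matrix (Fin d) (Fin d) K) (σ : State k K) (i : ℕ) (τ : State k K) :
    Prop where
  mod : Mod [4, 6, 7] [1, 3, 6, 7, 10] σ τ
  reduced : τ.IsReduced M
  eq_zero : ∀ j : Fin d, j.1 < i → τ.row d 6 0 j = 0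
  sub_mem : σ.row d 4 0 - τ.row d 6 0 ∈ τ.rowSpan d
  span_le : σ.rowSpan d ≤ τ.rowSpan d
  progress : τ.nat 4 0 0 = σ.nat 4 0 0 ∧ τ.rowSpan d = σ.rowSpan d ∨ σ.nat 4 0 0 < τ.nat 4 0 0

/-- Subtracting a multiple of row `p` clears coordinate `p` and, by triangularity, leaves the
earlier zeros alone. -/
theorem ReduceInv.eliminate {p : Fin d} {τ υ : State k K} (hi : ReduceInv M σ p τ)
    (hp : τ.row d 6 0 p = 0 ∨ τ.row d 3 p p ≠ 0) (hm : Mod [7] [6, 7, 10] τ υ)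
    (hυ : υ.row d 6 0
      = τ.row d 6 0 - ((τ.row d 3 p p)⁻¹ * τ.row d 6 0 p) • τ.row d 3 p) :
    ReduceInv M σ (p + 1) υ := by
  have h3 : ∀ x, υ.row d 3 x = τ.row d 3 x := State.row_of_mod hm (by simp) d
  have h1 : ∀ x, υ.row d 1 x = τ.row d 1 x := State.row_of_mod hm (by simp) d
  have hspan : υ.rowSpan d = τ.rowSpan d := by simp only [State.rowSpan, h3]
  refine ⟨hi.mod.trans (hm.mono (by simp) (by simp)), ?_, ?_, ?_, ?_, ?_⟩
  · have := hi.reduced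
    simpa only [State.IsReduced, h3, h1, hm.nat 4 (by simp)] using this
  · intro j hj
    rw [hυ]
    simp only [Pi.sub_apply, Pi.smul_apply, smul_eq_mul]
    rcases Nat.lt_or_ge j p with hjp | hjp
    · rw [hi.eq_zero j hjp, hi.reduced.tri p j hjp]
      simp
    · obtain rfl : j = p := Fin.ext (by omega)
      -- If the coordinate is already zero, the multiplier is zero too, even when the pivot vanishes
      -- and its inverse is the default `0`.
      rcases hp with hp | hp
      · simp [hp]
      · field_simp
        simp
  · rw [hspan, hυ, ← sub_add]
    exact Submodule.add_mem _ hi.sub_mem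
      (Submodule.smul_mem _ _ (Submodule.subset_span ⟨p, rfl⟩))
  · rw [hspan]
    exact hi.span_le
  · rw [hspan, hm.nat 4 (by simp)]
    exact hi.progress

theorem Test.eval_extIsZero [Field k] (σ : State k K) (x : Ref) :
    (Test.extIsZero x).eval σ = true ↔ x.get σ.nat σ.ext = 0 := by
  simp [Test.eval]

variable [Field k] [Algebra k K] {pb : PowerBasis k K} [Finite K] {q n : ℕ}

theorem trip_copyRow (hd : 1 ≤ d) (hdim : σ.nat 0 1 0 = d) {A C ρ : ℕ} {e : IExpr}
    (hA : A ≠ C) (he : e.cost ≤ 3)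
    (hρ : ∀ τ : State k K, Mod [7] [A] σ τ → e.eval τ.nat = ρ) :
    Trip pb (forLoop 7 dimExpr <| .extOp ⟨A, e, natVar 7⟩ (.copy ⟨C, .lit 0, natVar 7⟩)) σ
      (50 * (d * opCost K)) fun τ => Mod [7] [A] σ τ ∧
        ∀ x, τ.row d A x = if x = ρ then σ.row d C 0 else σ.row d A x := by
  have hκ : 1 ≤ opCost K := one_le_opCost K
  refine (Trip.forRow (A := A) (ρ := ρ) (T := 20 * opCost K) (d := d) [] []
    (fun j => σ.ext C 0 j) hdim (by simp) ?_).conseq ?_ ?_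
  · intro i hi τ h1 h2 h3
    refine Trip.mono ?_ (.extOp ⟨Mod.refl.set_ext (by simp) _ _ _, ?_⟩)
    · simp only [Ref.cost, IExpr.cost, FieldOp.cost]
      omega
    · intro x j
      simp [Ref.set, Ref.get, IExpr.eval, FieldOp.eval, Mem.set_self, h2, hρ τ h1,
        h1.ext C (by simp [hA.symm])]
  · exact row_cost_le hd (by omega)
  · rintro τ ⟨h1, h2⟩
    refine ⟨h1, fun x => ?_⟩
    split_ifs with hx
    · funext j
      simp [State.row, h2, hx]
    · funext j
      simp [State.row, h2, hx]

theorem trip_insertCmd (hd : 1 ≤ d) (h : HasInput q n M σ) (p : Fin d) (hp : σ.nat 6 0 0 = p) :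
    Trip pb insertCmd σ (120 * (d * opCost K)) fun τ => Mod [4, 7] [1, 3] σ τ
      ∧ (fun x : Fin d => τ.row d 3 x)
          = Function.update (fun x : Fin d => σ.row d 3 x) p (σ.row d 6 0)
      ∧ (fun i : ℕ => τ.row d 1 i)
          = Function.update (fun i : ℕ => σ.row d 1 i) (σ.nat 4 0 0) (σ.row d 4 0)
      ∧ τ.nat 4 0 0 = σ.nat 4 0 0 + 1 := by
  have hκ : 1 ≤ opCost K := one_le_opCost K
  have hdκ : 1 * opCost K ≤ d * opCost K := Nat.mul_le_mul_right _ hd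
  refine Trip.mono ?_ (.seq (T₂ := 65 * (d * opCost K)) ((trip_copyRow (ρ := p) hd h.dim (by simp)
    (by simp [IExpr.cost]) fun τ hτ => by simp [IExpr.eval, hτ.nat 6 (by simp), hp]).imp ?_))
  · omega
  rintro τ ⟨h1, h2⟩
  have hτ := h.of_mod h1 (by simp) (by simp)
  refine Trip.mono ?_ (.seq (T₂ := 13) ((trip_copyRow (ρ := σ.nat 4 0 0) hd hτ.dim (by simp)
    (by simp [IExpr.cost])
    fun υ hυ => by simp [IExpr.eval, hυ.nat 4 (by simp), h1.nat 4 (by simp)]).imp ?_))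
  · omega
  rintro υ ⟨h3, h4⟩
  refine Trip.mono ?_ (.natSet ⟨?_, ?_, ?_, ?_⟩)
  · simp [Ref.cost, IExpr.cost]
  · exact ((h1.mono (by simp) (by simp)).trans (h3.mono (by simp) (by simp))).set_nat (by simp) _ _ _
  · funext x
    refine Eq.trans ((State.row_of_mod h3 (by simp) d x).trans (h2 x)) ?_
    simp [Function.update_apply, Fin.ext_iff]
  · funext x
    refine Eq.trans (h4 x) ?_
    rw [State.row_of_mod h1 (by simp), State.row_of_mod h1 (by simp), Function.update_apply]
  · simp [Ref.set, IExpr.eval, Mem.set_self, h1.nat 4 (by simp), h3.nat 4 (by simp)]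

theorem trip_eliminateCmd (hd : 1 ≤ d) (h : HasInput q n M σ) (p : Fin d)
    (hp : σ.nat 6 0 0 = p) :
    Trip pb eliminateCmd σ (130 * (d * opCost K)) fun τ => Mod [7] [6, 7, 10] σ τ
      ∧ τ.row d 6 0
          = σ.row d 6 0 - ((σ.row d 3 p p)⁻¹ * σ.row d 6 0 p) • σ.row d 3 p := by
  have hκ : 1 ≤ opCost K := one_le_opCost K
  have hdκ : 1 * opCost K ≤ d * opCost K := Nat.mul_le_mul_right _ hd
  refine Trip.mono ?_ (.seq (T₂ := 115 * (d * opCost K)) ((Trip.extOp (Q := fun τ =>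
    Mod [] [7] σ τ ∧ τ.ext 7 0 0 = (σ.row d 3 p p)⁻¹) ⟨Mod.refl.set_ext (by simp) _ _ _, ?_⟩).imp ?_))
  · simp only [Ref.cost, IExpr.cost, FieldOp.cost]
    omega
  · simp [Ref.set, Ref.get, IExpr.eval, FieldOp.eval, Mem.set_self, State.row, hp]
  rintro τ ⟨h1, h2⟩
  refine Trip.mono ?_ (.seq (T₂ := 70 * (d * opCost K)) ((Trip.extOp (Q := fun υ =>
    Mod [] [7] σ υ ∧ υ.ext 7 0 0 = (σ.row d 3 p p)⁻¹ * σ.row d 6 0 p)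
      ⟨h1.trans (Mod.refl.set_ext (by simp) _ _ _), ?_⟩).imp ?_))
  · simp only [Ref.cost, IExpr.cost, FieldOp.cost]
    omega
  · simp [Ref.set, Ref.get, IExpr.eval, FieldOp.eval, Mem.set_self, h2, h1.nat 6 (by simp),
      h1.ext 6 (by simp), hp, State.row]
  rintro υ ⟨h3, h4⟩
  set a := (σ.row d 3 p p)⁻¹ * σ.row d 6 0 p with ha
  refine (Trip.forRow (A := 6) (ρ := 0) (T := 40 * opCost K) (d := d) [] [10]
    (fun j => σ.ext 6 0 j - a * σ.ext 3 p j) (h.of_mod h3 (by simp) (by simp)).dim (by simp)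
      ?_).conseq (row_cost_le hd (by omega)) ?_
  · intro i hi ω h5 h6 h7
    refine Trip.mono ?_ (.seq (.extOp (.extOp ⟨?_, ?_⟩)))
    · simp only [Ref.cost, IExpr.cost, FieldOp.cost]
      omega
    · exact (Mod.refl.set_ext (by simp) _ _ _).set_ext (by simp) _ _ _
    · intro x j
      simp [Ref.set, Ref.get, IExpr.eval, FieldOp.eval, Mem.set_self, Mem.set_of_ne, h6, h7,
        h5.nat 6 (by simp), h3.nat 6 (by simp), h5.ext 3 (by simp), h3.ext 3 (by simp),
        h5.ext 7 (by simp), h3.ext 6 (by simp), h4, hp]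
  · rintro ω ⟨h5, h6⟩
    refine ⟨(h3.mono (by simp) (by simp)).trans (h5.mono (by simp) (by simp)), ?_⟩
    funext j
    simp [State.row, h6]

/-- Secures the alternative that elimination needs: either nothing is to be cleared or a pivot
exists. After an insertion the next elimination cancels the work row against its own copy, so the
loop needs no early exit. -/
theorem trip_branch_insertCmd (hd : 1 ≤ d) (h : HasInput q n M σ)
    (hfix : twist k M (σ.row d 4 0) = σ.row d 4 0) (p : Fin d) {τ : State k K}
    (hi : ReduceInv M σ p τ) (hp : τ.nat 6 0 0 = p) :
    Trip pb (.branch (.extIsZero ⟨6, .lit 0, natVar 6⟩) .skip <|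
      .branch (.extIsZero ⟨3, natVar 6, natVar 6⟩) insertCmd .skip) τ (150 * (d * opCost K))
      fun υ => ReduceInv M σ p υ ∧ υ.nat 6 0 0 = p
        ∧ (υ.row d 6 0 p = 0 ∨ υ.row d 3 p p ≠ 0) := by
  have hκ : 1 ≤ opCost K := one_le_opCost K
  have hdκ : 1 * opCost K ≤ d * opCost K := Nat.mul_le_mul_right _ hd
  refine Trip.mono ?_ (.branch (T := 140 * (d * opCost K))
    (fun ht => Trip.mono (by omega) (.skip ⟨hi, hp, ?_⟩))
    fun ht => Trip.mono ?_ (.branch (T := 120 * (d * opCost K)) (fun ht' => ?_)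
      (fun ht' => Trip.mono (by omega) (.skip ⟨hi, hp, ?_⟩))))
  · simp only [Ref.cost, IExpr.cost, Test.cost]
    omega
  · left
    simpa [Test.eval_extIsZero, Ref.get, IExpr.eval, hp, State.row] using ht
  · simp only [Ref.cost, IExpr.cost, Test.cost]
    omega
  · have hR : τ.row d 6 0 p ≠ 0 := by
      rw [← Bool.not_eq_true, Test.eval_extIsZero] at ht
      simpa [Ref.get, IExpr.eval, hp, State.row] using ht
    have hE : τ.row d 3 p p = 0 := by
      simpa [Test.eval_extIsZero, Ref.get, IExpr.eval, hp, State.row] using ht'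
    refine (trip_insertCmd hd (h.of_mod hi.mod (by simp) (by simp)) p hp).imp ?_
    rintro υ ⟨h1, h2, h3, h4⟩
    have hle : τ.rowSpan d ≤ υ.rowSpan d := by
      simp only [State.rowSpan]
      rw [h2]
      exact IsEchelon.range_le_span_update hi.reduced hE _
    have hT : τ.row d 4 0 = σ.row d 4 0 := State.row_of_mod hi.mod (by simp) d 0
    have hR6 : υ.row d 6 0 = τ.row d 6 0 := State.row_of_mod h1 (by simp) d 0
    refine ⟨⟨hi.mod.trans (h1.mono (by simp) (by simp)), ?_, ?_, ?_, hi.span_le.trans hle, ?_⟩,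
      ?_, Or.inr ?_⟩
    · rw [State.IsReduced, h2, h3, h4]
      refine IsEchelon.insert hi.reduced hE (fun j hj => hi.eq_zero j hj) hR ?_ ?_
      · rw [hT]
        exact hi.sub_mem
      · rw [hT, hfix]
    · rw [hR6]
      exact hi.eq_zero
    · rw [hR6]
      exact hle hi.sub_mem
    · right
      rw [h4]
      rcases hi.progress with ⟨h5, -⟩ | h5 <;> omega
    · rw [h1.nat 6 (by simp), hp]
    · have := congrFun h2 p
      simp only [Function.update_self] at this
      rwa [this]
  · right
    rw [← Bool.not_eq_true, Test.eval_extIsZero] at ht'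
    simpa [Ref.get, IExpr.eval, hp, State.row] using ht'

/-- At the end the work row is zero, so the trace lies in the new span. If it was not in the old
span, the span has changed, which forces the row count to grow. -/
theorem trip_reduceCmd (hd : 1 ≤ d) (h : HasInput q n M σ) (hred : σ.IsReduced M)
    (hfix : twist k M (σ.row d 4 0) = σ.row d 4 0) :
    Trip pb reduceCmd σ (400 * (d * (d * opCost K))) fun τ =>
      Mod [4, 6, 7] [1, 3, 6, 7, 10] σ τ ∧ τ.IsReduced M ∧ σ.row d 4 0 ∈ τ.rowSpan d
        ∧ σ.rowSpan d ≤ τ.rowSpan d ∧ σ.nat 4 0 0 ≤ τ.nat 4 0 0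
        ∧ (σ.row d 4 0 ∉ σ.rowSpan d → σ.nat 4 0 0 < τ.nat 4 0 0) := by
  have hκ : 1 ≤ opCost K := one_le_opCost K
  have hdκ : 1 * opCost K ≤ d * opCost K := Nat.mul_le_mul_right _ hd
  have hddκ : 1 * (d * opCost K) ≤ d * (d * opCost K) := Nat.mul_le_mul_right _ hd
  refine Trip.mono ?_ (.seq (T₂ := 340 * (d * (d * opCost K))) ((trip_copyRow (ρ := 0) hd h.dim
    (by simp) (by simp [IExpr.cost]) fun τ hτ => by simp [IExpr.eval]).imp ?_))
  · omega
  rintro τ ⟨h1, h2⟩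
  refine (Trip.forLoop (n := d) (T := 300 * (d * opCost K)) (by simp [IExpr.cost])
    (ReduceInv M σ) ?_ ?_ ?_ ?_).conseq (row_cost_le hd (by omega)) ?_
  · intro i τ v hi
    exact ⟨hi.mod.set_nat (by simp) _ _ _, hi.reduced, hi.eq_zero, hi.sub_mem, hi.span_le,
      hi.progress⟩
  · have h3 : ∀ x, τ.row d 3 x = σ.row d 3 x := State.row_of_mod h1 (by simp) d
    have h4 : ∀ x, τ.row d 1 x = σ.row d 1 x := State.row_of_mod h1 (by simp) d
    have hspan : τ.rowSpan d = σ.rowSpan d := by simp only [State.rowSpan, h3]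
    refine ⟨h1.mono (by simp) (by simp), ?_, by simp, ?_, hspan.ge, Or.inl ⟨?_, hspan⟩⟩
    · simpa only [State.IsReduced, h3, h4, h1.nat 4 (by simp)] using hred
    · rw [h2 0]
      simp
    · rw [h1.nat 4 (by simp)]
  · intro i τ hi
    simp [IExpr.eval, hi.mod.nat 0 (by simp), h.dim]
  · intro i hid υ hi hp
    refine Trip.mono ?_ (.seq (T₂ := 130 * (d * opCost K))
      ((trip_branch_insertCmd hd h hfix ⟨i, hid⟩ hi hp).imp ?_))
    · omega
    rintro ω ⟨h3, h4, h5⟩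
    refine (trip_eliminateCmd hd (h.of_mod h3.mod (by simp) (by simp)) ⟨i, hid⟩ h4).imp ?_
    rintro φ ⟨h6, h7⟩
    exact ⟨by rw [h6.nat 6 (by simp), h4], h3.eliminate h5 h6 h7⟩
  · intro υ hi
    have hzero : υ.row d 6 0 = 0 := funext fun j => hi.eq_zero j j.2
    have hmem : σ.row d 4 0 ∈ υ.rowSpan d := by simpa [hzero] using hi.sub_mem
    refine ⟨hi.mod, hi.reduced, hmem, hi.span_le, ?_, fun hnot => ?_⟩
    · rcases hi.progress with ⟨h3, -⟩ | h3 <;> omega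
    · rcases hi.progress with ⟨-, h3⟩ | h3
      · exact absurd (h3 ▸ hmem) hnot
      · exact h3

theorem trip_processCmd [Finite k] (hq : 2 ≤ q) (hd : 1 ≤ d) (hn : 1 ≤ n) (hk : q = Nat.card k)
    (h : HasInput q n M σ) (hred : σ.IsReduced M) (hfix : ∀ v, (twist k M)^[n] v = v) :
    Trip pb processCmd σ (1500 * (n * (d * d * (Nat.clog 2 q * opCost K)))) fun τ =>
      Mod [4, 6, 7, 8, 9, 10, 11] [1, 3, 4, 5, 6, 7, 8, 9, 10] σ τ ∧ τ.IsReduced M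
        ∧ twistedTrace k M n (σ.row d 5 0) ∈ τ.rowSpan d
        ∧ σ.rowSpan d ≤ τ.rowSpan d ∧ σ.nat 4 0 0 ≤ τ.nat 4 0 0
        ∧ (twistedTrace k M n (σ.row d 5 0) ∉ σ.rowSpan d → σ.nat 4 0 0 < τ.nat 4 0 0) := by
  have hκ : 1 ≤ opCost K := one_le_opCost K
  have hL : 1 ≤ Nat.clog 2 q := Nat.clog_pos one_lt_two hq
  refine Trip.mono ?_ (.seq (T₂ := 400 * (d * (d * opCost K)))
    ((trip_traceCmd hq hd hn hk h).imp ?_))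
  · have h1 : d * (d * opCost K) * (1 * 1)
        ≤ d * (d * opCost K) * (n * Nat.clog 2 q) :=
      Nat.mul_le_mul_left _ (Nat.mul_le_mul hn hL)
    have h2 : 1 * (1 * 1) ≤ d * (d * opCost K) :=
      Nat.mul_le_mul hd (Nat.mul_le_mul hd hκ)
    have h3 : d * (d * opCost K) * (n * Nat.clog 2 q)
      = n * (d * d * (Nat.clog 2 q * opCost K)) := by ring
    omega
  rintro τ ⟨h1, h2⟩
  have h3 : ∀ x, τ.row d 3 x = σ.row d 3 x := State.row_of_mod h1 (by simp) d
  have h4 : ∀ x, τ.row d 1 x = σ.row d 1 x := State.row_of_mod h1 (by simp) d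
  have hspan : τ.rowSpan d = σ.rowSpan d := by simp only [State.rowSpan, h3]
  have hτ : τ.IsReduced M := by
    simpa only [State.IsReduced, h3, h4, h1.nat 4 (by simp)] using hred
  refine (trip_reduceCmd hd (h.of_mod h1 (by simp) (by simp)) hτ ?_).imp ?_
  · rw [h2]
    exact twist_twistedTrace k M n _ (hfix _)
  rintro υ ⟨h5, h6, h7, h8, h9, h10⟩
  rw [h2] at h7 h10
  rw [hspan] at h8 h10
  rw [h1.nat 4 (by simp)] at h9 h10
  exact ⟨(h1.mono (by simp) (by simp)).trans (h5.mono (by simp) (by simp)), h6, h7, h8, h9, h10⟩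

end ReduceProgram

/-! ### The two programs, and the analysis of the deterministic one. -/

section MainPrograms

/-- The degree `n = r * s` is put into the variable `1`. -/
def degreeCmd : Cmd :=
  forLoop 2 (.cell 0 (.lit 3) (.lit 0)) <|
    .natSet (scalar 1) (.add (natVar 1) (.cell 0 (.lit 2) (.lit 0)))

/-- The row in the array `5` becomes the multiple of the standard basis vector `natVar 2` by the
element in the cell `(0, 0)` of the array `2`. -/
def singleCmd : Cmd :=
  .seq (forLoop 7 dimExpr <| .extOp ⟨5, .lit 0, natVar 7⟩ .zero)
    (.extOp ⟨5, .lit 0, natVar 2⟩ (.copy (scalar 2)))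

/-- The multiples of all standard basis vectors by the element in the cell `(0, 0)` of the array
`2` are processed. -/
def multiplesCmd : Cmd := forLoop 2 dimExpr <| .seq singleCmd processCmd

/-- The deterministic program: process the multiples of the standard basis vectors by the powers
of the generator. -/
def deterministicCmd : Cmd :=
  .seq degreeCmd <|
  .seq (.gen ⟨2, .lit 0, .lit 1⟩) <|
  .seq (.extOp (scalar 2) .one) <|
  forLoop 3 (natVar 1) <|
    .seq multiplesCmd (.extOp (scalar 2) (.mul (scalar 2) ⟨2, .lit 0, .lit 1⟩))

/-- The row in the array `5` becomes a random vector. -/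
def randomRowCmd : Cmd := forLoop 7 dimExpr <| .rand ⟨5, .lit 0, natVar 7⟩

/-- The Las Vegas program: process random vectors until `d` rows have been stored. -/
def lasVegasCmd : Cmd :=
  .seq degreeCmd <| .loop (.lt (natVar 4) dimExpr) <| .seq randomRowCmd processCmd

variable {k K : Type*} [Field k] [Field K] {q n r s d : ℕ} {M : Matrix (Fin d) (Fin d) K}
  {σ : State k K}

theorem isReduced_initState : (initState q r s M : State k K).IsReduced M := by
  have h3 : (fun p : Fin d => (initState q r s M : State k K).row d 3 p) = fun _ _ => 0 := by
    funext p j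
    simp [State.row, initState]
  have h4 : (initState q r s M : State k K).nat 4 0 0 = 0 := by simp [initState]
  rw [State.IsReduced, h3, h4]
  exact IsEchelon.empty

variable [Algebra k K] {pb : PowerBasis k K}

/-- The machine does not multiply natural numbers, so `r` is added `s` times. -/
theorem trip_degreeCmd (hn : n = r * s) :
    Trip pb degreeCmd (initState q r s M) (40 * s + 12) fun τ => HasInput q n M τ ∧ τ.IsReduced M := by
  set σ : State k K := initState q r s M with hσ
  have h0 : σ.nat 0 0 0 = q ∧ σ.nat 0 1 0 = d ∧ σ.nat 0 2 0 = r ∧ σ.nat 0 3 0 = s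
      ∧ σ.nat 1 0 0 = 0 := by simp [hσ, initState]
  refine (Trip.forLoop (n := s) (T := 20) (by simp [IExpr.cost])
    (fun i τ => Mod [1, 2] [] σ τ ∧ τ.nat 1 0 0 = r * i) ?_ ?_ ?_ ?_).conseq (by omega) ?_
  · rintro i τ v ⟨h1, h2⟩
    exact ⟨h1.set_nat (by simp) _ _ _, by simp [Mem.set_of_ne, h2]⟩
  · exact ⟨Mod.refl, by simp [h0]⟩
  · rintro i τ ⟨h1, -⟩
    simp [IExpr.eval, h1.nat 0 (by simp), h0]
  · rintro i hi τ ⟨h1, h2⟩ h3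
    refine Trip.mono ?_ (.natSet ⟨?_, h1.set_nat (by simp) _ _ _, ?_⟩)
    · simp [Ref.cost, IExpr.cost]
    · simp [Ref.set, IExpr.eval, Mem.set_of_ne, h3]
    · simp [Ref.set, IExpr.eval, Mem.set_self, h2, h1.nat 0 (by simp), h0, Nat.mul_succ]
  · rintro τ ⟨h1, h2⟩
    refine ⟨⟨?_, ?_, by rw [h2, hn], fun i j => ?_⟩, ?_⟩
    · rw [h1.nat 0 (by simp), h0.1]
    · rw [h1.nat 0 (by simp), h0.2.1]
    · rw [h1.ext 0 (by simp)]
      simp [hσ, initState]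
    · have h3 : ∀ A x, τ.row d A x = σ.row d A x := fun A => State.row_of_mod h1 (by simp) d
      have : σ.IsReduced M := isReduced_initState
      simpa only [State.IsReduced, h3, h1.nat 4 (by simp)] using this

variable [Finite K]

theorem trip_singleCmd (hd : 1 ≤ d) (h : HasInput q n M σ) (i : Fin d) (hi : σ.nat 2 0 0 = i) :
    Trip pb singleCmd σ (80 * (d * opCost K)) fun τ => Mod [7] [5] σ τ
      ∧ τ.row d 5 0 = Pi.single i (σ.ext 2 0 0) := by
  have hκ : 1 ≤ opCost K := one_le_opCost K
  have hdκ : 1 * opCost K ≤ d * opCost K := Nat.mul_le_mul_right _ hd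
  refine Trip.mono ?_ (.seq (T₂ := 15 * opCost K) (((Trip.forRow (A := 5) (ρ := 0)
    (T := 20 * opCost K) (d := d) [] [] (fun _ => 0) h.dim (by simp) ?_).mono
      (row_cost_le (C := 50) (B := opCost K) hd (by omega))).imp ?_))
  · omega
  · intro j hj τ h1 h2 h3
    refine Trip.mono ?_ (.extOp ⟨Mod.refl.set_ext (by simp) _ _ _, ?_⟩)
    · simp only [Ref.cost, IExpr.cost, FieldOp.cost]
      omega
    · intro x l
      simp [Ref.set, IExpr.eval, FieldOp.eval, Mem.set_self, h2]
  · rintro τ ⟨h1, h2⟩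
    refine Trip.mono ?_ (.extOp ⟨h1.set_ext (by simp) _ _ _, ?_⟩)
    · simp only [Ref.cost, IExpr.cost, FieldOp.cost]
      omega
    · funext j
      simp [State.row, Ref.set, Ref.get, IExpr.eval, FieldOp.eval, Mem.set_self, h2,
        h1.nat 2 (by simp), h1.ext 2 (by simp), hi, Pi.single_apply, Fin.ext_iff]

variable [Finite k]

theorem trip_multiplesCmd (hq : 2 ≤ q) (hd : 1 ≤ d) (hn : 1 ≤ n) (hk : q = Nat.card k)
    (h : HasInput q n M σ) (hred : σ.IsReduced M) (hfix : ∀ v, (twist k M)^[n] v = v) :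
    Trip pb multiplesCmd σ (1700 * (d * (n * (d * d * (Nat.clog 2 q * opCost K))))) fun τ =>
      Mod [2, 4, 6, 7, 8, 9, 10, 11] [1, 3, 4, 5, 6, 7, 8, 9, 10] σ τ ∧ τ.IsReduced M
        ∧ σ.rowSpan d ≤ τ.rowSpan d
        ∧ ∀ i : Fin d, twistedTrace k M n (Pi.single i (σ.ext 2 0 0)) ∈ τ.rowSpan d := by
  have hκ : 1 ≤ opCost K := one_le_opCost K
  have hL : 1 ≤ Nat.clog 2 q := Nat.clog_pos one_lt_two hq
  have hX : 1 * (d * 1 * (1 * opCost K)) ≤ n * (d * d * (Nat.clog 2 q * opCost K)) :=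
    Nat.mul_le_mul hn (Nat.mul_le_mul (Nat.mul_le_mul_left _ hd) (Nat.mul_le_mul_right _ hL))
  have hdκ : 1 * 1 ≤ d * opCost K := Nat.mul_le_mul hd hκ
  simp only [one_mul, mul_one] at hX hdκ
  set X := n * (d * d * (Nat.clog 2 q * opCost K)) with hXdef
  refine (Trip.forLoop (n := d) (T := 1600 * X) (by simp [IExpr.cost])
    (fun i τ => Mod [2, 4, 6, 7, 8, 9, 10, 11] [1, 3, 4, 5, 6, 7, 8, 9, 10] σ τ ∧ τ.IsReduced M
      ∧ σ.rowSpan d ≤ τ.rowSpan d ∧ ∀ i' : Fin d, i'.1 < i →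
        twistedTrace k M n (Pi.single i' (σ.ext 2 0 0)) ∈ τ.rowSpan d) ?_ ?_ ?_ ?_).conseq
    (row_cost_le hd (by omega)) ?_
  · rintro i τ v ⟨h1, h2⟩
    exact ⟨h1.set_nat (by simp) _ _ _, h2⟩
  · exact ⟨Mod.refl, hred, le_rfl, by simp⟩
  · rintro i τ ⟨h1, -⟩
    simp [IExpr.eval, h1.nat 0 (by simp), h.dim]
  · rintro i hi τ ⟨h1, h2, h3, h4⟩ h5
    have hτ := h.of_mod h1 (by simp) (by simp)
    refine Trip.mono ?_ (.seq (T₂ := 1500 * X) ((trip_singleCmd hd hτ ⟨i, hi⟩ h5).imp ?_))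
    · omega
    rintro υ ⟨h6, h7⟩
    have hr : ∀ A ∉ [5], ∀ x, υ.row d A x = τ.row d A x := fun A hA => State.row_of_mod h6 hA d
    have hspan : υ.rowSpan d = τ.rowSpan d := by simp only [State.rowSpan, hr 3 (by simp)]
    have hred' : υ.IsReduced M := by
      simpa only [State.IsReduced, hr 3 (by simp), hr 1 (by simp), h6.nat 4 (by simp)] using h2
    refine (trip_processCmd hq hd hn hk (hτ.of_mod h6 (by simp) (by simp)) hred' hfix).imp ?_
    rintro ω ⟨h8, h9, h10, h11, -⟩
    rw [h7, h1.ext 2 (by simp)] at h10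
    rw [hspan] at h11
    refine ⟨by rw [h8.nat 2 (by simp), h6.nat 2 (by simp), h5],
      (h1.trans (h6.mono (by simp) (by simp))).trans (h8.mono (by simp) (by simp)), h9,
      h3.trans h11, fun i' hi' => ?_⟩
    rcases Nat.lt_or_ge i'.1 i with hlt | hge
    · exact h11 (h4 i' hlt)
    · obtain rfl : i' = ⟨i, hi⟩ := Fin.ext (by simp; omega)
      exact h10
  · rintro τ ⟨h1, h2, h3, h4⟩
    exact ⟨h1, h2, h3, fun i => h4 i i.2⟩

theorem trip_deterministicCmd (hq : 2 ≤ q) (hd : 1 ≤ d) (hr : 1 ≤ r) (hs : 1 ≤ s)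
    (hk : q = Nat.card k) (hn : Module.finrank k K = r * s)
    (hfix : ∀ v, (twist k M)^[Module.finrank k K] v = v) :
    Trip pb deterministicCmd (initState q r s M)
      (2000 * (r * s * (d * (r * s * (d * d * (Nat.clog 2 q * opCost K)))))) fun τ =>
        τ.IsReduced M ∧ τ.nat 4 0 0 = d := by
  have hκ : 1 ≤ opCost K := one_le_opCost K
  have hL : 1 ≤ Nat.clog 2 q := Nat.clog_pos one_lt_two hq
  have hsn : 1 * s ≤ r * s := Nat.mul_le_mul_right _ hr
  rw [← hn] at hsn ⊢
  set n := Module.finrank k K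
  have hn1 : 1 ≤ n := by omega
  have hX : 1 * (1 * (1 * 1 * (1 * opCost K)))
      ≤ d * (n * (d * d * (Nat.clog 2 q * opCost K))) :=
    Nat.mul_le_mul hd (Nat.mul_le_mul hn1
      (Nat.mul_le_mul (Nat.mul_le_mul hd hd) (Nat.mul_le_mul_right _ hL)))
  simp only [one_mul] at hX hsn
  set X := d * (n * (d * d * (Nat.clog 2 q * opCost K))) with hXdef
  have hnX : n * opCost K ≤ n * X := Nat.mul_le_mul_left _ hX
  have hnκ : n * 1 ≤ n * opCost K := Nat.mul_le_mul_left _ hκ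
  have hnκ' : 1 * opCost K ≤ n * opCost K := Nat.mul_le_mul_right _ hn1
  refine Trip.mono ?_ (.seq (T₂ := 1900 * (n * X)) ((trip_degreeCmd hn).imp ?_))
  · omega
  rintro σ ⟨hσ, hred⟩
  refine Trip.mono ?_ (.seq (T₂ := 1850 * (n * X)) ((Trip.gen (Q := fun τ => Mod [] [2] σ τ
    ∧ τ.ext 2 0 1 = pb.gen) ⟨Mod.refl.set_ext (by simp) _ _ _, ?_⟩).imp ?_))
  · simp only [Ref.cost, IExpr.cost]
    omega
  · simp [Ref.set, IExpr.eval, Mem.set_self]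
  rintro τ ⟨h1, h2⟩
  refine Trip.mono ?_ (.seq (T₂ := 1800 * (n * X)) ((Trip.extOp (Q := fun υ => Mod [] [2] σ υ
    ∧ υ.ext 2 0 1 = pb.gen ∧ υ.ext 2 0 0 = 1)
      ⟨h1.trans (Mod.refl.set_ext (by simp) _ _ _), ?_, ?_⟩).imp ?_))
  · simp only [Ref.cost, IExpr.cost, FieldOp.cost]
    omega
  · simp [Ref.set, IExpr.eval, Mem.set_self, h2]
  · simp [Ref.set, IExpr.eval, Mem.set_self, FieldOp.eval]
  rintro υ ⟨h3, h4, h5⟩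
  refine (Trip.forLoop (n := n) (T := 1750 * X) (by simp [IExpr.cost])
    -- After `j` passes the traces of all `gen^j' e_i` with `j' < j` lie in the row span; for `j =
    -- n` this makes the span everything, so the row count is `d`.
    (fun j ω => Mod [2, 3, 4, 6, 7, 8, 9, 10, 11] [1, 2, 3, 4, 5, 6, 7, 8, 9, 10] σ ω
      ∧ ω.ext 2 0 1 = pb.gen ∧ ω.ext 2 0 0 = pb.gen ^ j ∧ ω.IsReduced M
      ∧ ∀ j' < j, ∀ i : Fin d, twistedTrace k M n (Pi.single i (pb.gen ^ j')) ∈ ω.rowSpan d)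
    ?_ ?_ ?_ ?_).conseq (row_cost_le hn1 (by omega)) ?_
  · rintro j ω v ⟨h6, h7⟩
    exact ⟨h6.set_nat (by simp) _ _ _, h7⟩
  · refine ⟨h3.mono (by simp) (by simp), h4, by simpa using h5, ?_, by simp⟩
    have hrow : ∀ A ∉ [2], ∀ x, υ.row d A x = σ.row d A x := fun A hA => State.row_of_mod h3 hA d
    simpa only [State.IsReduced, hrow 3 (by simp), hrow 1 (by simp), h3.nat 4 (by simp)] using hred
  · rintro j ω ⟨h6, -⟩
    simp [IExpr.eval, h6.nat 1 (by simp), hσ.deg]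
  · rintro j hj ω ⟨h6, h7, h8, h9, h10⟩ h11
    refine Trip.mono ?_ (.seq (T₂ := 20 * opCost K) ((trip_multiplesCmd hq hd hn1 hk
      (hσ.of_mod h6 (by simp) (by simp)) h9 hfix).imp ?_))
    · omega
    rintro φ ⟨h12, h13, h14, h15⟩
    refine Trip.mono ?_ (.extOp ⟨?_, ?_, ?_, ?_, ?_, ?_⟩)
    · simp only [Ref.cost, IExpr.cost, FieldOp.cost]
      omega
    · simp [h12.nat 3 (by simp), h11]
    · exact (h6.trans (h12.mono (by simp) (by simp))).set_ext (by simp) _ _ _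
    · simp [Ref.set, IExpr.eval, Mem.set_self, h12.ext 2 (by simp), h7]
    · simp [Ref.set, Ref.get, IExpr.eval, FieldOp.eval, Mem.set_self, h12.ext 2 (by simp), h7, h8,
        pow_succ]
    · exact h13
    · intro j' hj' i
      rcases Nat.lt_or_ge j' j with hlt | hge
      · exact h14 (h10 j' hlt i)
      · obtain rfl : j' = j := by omega
        rw [← h8]
        exact h15 i
  · rintro ω ⟨-, -, -, h9, h10⟩
    refine ⟨h9, IsEchelon.eq_of_span_eq_top h9 ?_⟩
    exact eq_top_of_twistedTrace_single_mem k M pb fun i j hj => h10 j hj i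

end MainPrograms

/-! ### Random vectors and the expected time of the Las Vegas program. -/

section LasVegas

/-- Resampling one coordinate of a uniform vector leaves it uniform: exchanging `z` with the
coordinate `w i` is an involution of the pairs `(z, w)`. -/
theorem sum_sum_update {K : Type*} [Fintype K] {d : ℕ} (i : Fin d) (F : (Fin d → K) → ℝ≥0∞) :
    ∑ z : K, ∑ w, F (Function.update w i z) = Fintype.card K * ∑ w, F w := by
  let e : (K × (Fin d → K)) ≃ (K × (Fin d → K)) :=
    Function.Involutive.toPerm (fun p => (p.2 i, Function.update p.2 i p.1)) fun p => by simp
  calc ∑ z : K, ∑ w, F (Function.update w i z)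
      = ∑ p : K × (Fin d → K), F (Function.update p.2 i p.1) := by rw [Fintype.sum_prod_type]
    _ = ∑ p : K × (Fin d → K), F p.2 := Equiv.sum_comp e fun p => F p.2
    _ = Fintype.card K * ∑ w, F w := by
      rw [Fintype.sum_prod_type]
      simp

theorem sum_const_add_div {ι : Type*} [Fintype ι] [Nonempty ι] (a b N : ℝ≥0∞) (S : ι → ℝ≥0∞)
    (hS : ∑ i, S i = Fintype.card ι * b) :
    (∑ i, (a + S i / N)) / (Fintype.card ι : ℝ≥0∞) = a + b / N := by
  have h0 : (Fintype.card ι : ℝ≥0∞) ≠ 0 := by simp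
  have h1 : (Fintype.card ι : ℝ≥0∞) ≠ ∞ := by simp
  simp only [div_eq_mul_inv] at *
  rw [Finset.sum_add_distrib, ← Finset.sum_mul, hS, Finset.sum_const, nsmul_eq_mul,
    Finset.card_univ, add_mul, mul_right_comm, ENNReal.mul_inv_cancel h0 h1, one_mul,
    mul_right_comm _ N⁻¹, mul_right_comm _ b, ENNReal.mul_inv_cancel h0 h1, one_mul]

variable {k K : Type*} [Field K] {q n r s d : ℕ} {M : Matrix (Fin d) (Fin d) K} {σ : State k K}

open Classical in
/-- The postcondition of both programs, as a function that is infinite where it fails. -/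
def failure (M : Matrix (Fin d) (Fin d) K) (τ : State k K) : ℝ≥0∞ :=
  if τ.IsReduced M ∧ τ.nat 4 0 0 = d then 0 else ∞

open Classical in
/-- The potential function of the loop of the Las Vegas program. -/
def potential (q n B : ℕ) (M : Matrix (Fin d) (Fin d) K) (τ : State k K) : ℝ≥0∞ :=
  -- The `7` pays for the last test; each missing row is allowed two trials of cost `B`. Outside the
  -- invariant the bound is vacuous.
  if HasInput q n M τ ∧ τ.IsReduced M then ((7 + 2 * B * (d - τ.nat 4 0 0) : ℕ) : ℝ≥0∞) else ∞

theorem potential_of {B : ℕ} (h : HasInput q n M σ) (hred : σ.IsReduced M) :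
    potential q n B M σ = ((7 + 2 * B * (d - σ.nat 4 0 0) : ℕ) : ℝ≥0∞) :=
  if_pos ⟨h, hred⟩

variable [Field k] [Algebra k K] {pb : PowerBasis k K} [Fintype K]

/-- The expected value after the last `d - i` coordinates of a vector have been chosen at random. -/
def randomCompletion (H : (Fin d → K) → ℝ≥0∞) (i : ℕ) (v : Fin d → K) : ℝ≥0∞ :=
  (∑ w : Fin d → K, H fun j => if j.1 < i then v j else w j) / (Fintype.card (Fin d → K) : ℝ≥0∞)

/-- Coordinates are drawn one at a time; with the first `i` fixed, the expected value is at most the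
mean of `H` over all completions. Induction on the number `j` of coordinates still to be drawn. -/
theorem ert_randomRow_loop_le (f : State k K → ℝ≥0∞) (H : (Fin d → K) → ℝ≥0∞)
    (hdim : σ.nat 0 1 0 = d) (hf : ∀ τ, Mod [7] [5] σ τ → f τ ≤ H (τ.row d 5 0)) :
    ∀ j i, i + j = d → ∀ τ, Mod [7] [5] σ τ → τ.nat 7 0 0 = i →
      ert pb (.loop (.lt (natVar 7) dimExpr)
        (.seq (.rand ⟨5, .lit 0, natVar 7⟩) (.natSet (scalar 7) (.add (natVar 7) (.lit 1))))) f τ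
        ≤ ((j * (opCost K + 21) + 7 : ℕ) : ℝ≥0∞) + randomCompletion H i (τ.row d 5 0) := by
  intro j
  induction j with
  | zero =>
    intro i hi τ hτ h7
    obtain rfl : i = d := by omega
    have ht : (Test.lt (natVar 7) dimExpr).eval τ = false := by
      simp [Test.eval, IExpr.eval, h7, hτ.nat 0 (by simp), hdim]
    have hH : randomCompletion H i (τ.row i 5 0) = H (τ.row i 5 0) := by
      simp only [randomCompletion, Fin.is_lt, if_true, Finset.sum_const, Finset.card_univ,
        nsmul_eq_mul]
      rw [mul_comm]
      exact ENNReal.mul_div_cancel_right (by simp) (by simp)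
    rw [ert_loop, ht, hH]
    simp only [Test.cost, IExpr.cost]
    norm_num
    exact hf τ hτ
  | succ j ih =>
    intro i hi τ hτ h7
    have ht : (Test.lt (natVar 7) dimExpr).eval τ = true := by
      simp [Test.eval, IExpr.eval, h7, hτ.nat 0 (by simp), hdim]
      omega
    have hid : i < d := by omega
    rw [ert_loop, ht]
    simp only [if_true]
    set g := ert pb (.loop (.lt (natVar 7) dimExpr)
        (.seq (.rand ⟨5, .lit 0, natVar 7⟩) (.natSet (scalar 7) (.add (natVar 7) (.lit 1))))) f
    have hz : ∀ z : K, ert pb (.natSet (scalar 7) (.add (natVar 7) (.lit 1))) g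
        { τ with ext := (⟨5, .lit 0, natVar 7⟩ : Ref).set τ.nat τ.ext z }
        ≤ ((8 + (j * (opCost K + 21) + 7) : ℕ) : ℝ≥0∞)
          + (∑ w, H fun l => if l.1 < i then τ.row d 5 0 l
              else Function.update w ⟨i, hid⟩ z l) / (Fintype.card (Fin d → K) : ℝ≥0∞) := by
      intro z
      simp only [ert, stepCost, step]
      refine (add_le_add_right (ih (i + 1) (by omega) _ ?_ ?_) _).trans (le_of_eq ?_)
      · exact (hτ.set_ext (by simp) _ _ _).set_nat (by simp) _ _ _
      · simp [Ref.set, IExpr.eval, Mem.set_self, h7]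
      · rw [← add_assoc, ← Nat.cast_add, randomCompletion]
        congr 2
        refine Finset.sum_congr rfl fun w _ => congrArg H (funext fun l => ?_)
        simp only [State.row, Ref.set, IExpr.eval, Mem.set_self, h7]
        rcases lt_trichotomy l.1 i with hl | hl | hl
        · simp [hl, hl.ne, show l.1 < i + 1 by omega]
        · obtain rfl : l = ⟨i, hid⟩ := Fin.ext hl
          simp
        · have : l ≠ ⟨i, hid⟩ := fun h => by simp [h] at hl
          simp [this, show ¬ l.1 < i + 1 by omega, show ¬ l.1 < i by omega]
    have hsum : (∑' z : K, ert pb (.natSet (scalar 7) (.add (natVar 7) (.lit 1))) g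
        { τ with ext := (⟨5, .lit 0, natVar 7⟩ : Ref).set τ.nat τ.ext z }) / (Nat.card K : ℝ≥0∞)
        ≤ ((8 + (j * (opCost K + 21) + 7) : ℕ) : ℝ≥0∞)
          + randomCompletion H i (τ.row d 5 0) := by
      rw [tsum_fintype, Nat.card_eq_fintype_card, randomCompletion, ← sum_const_add_div _ _ _ _
        (sum_sum_update ⟨i, hid⟩ fun w => H fun l => if l.1 < i then τ.row d 5 0 l else w l)]
      gcongr with z
      exact hz z
    -- One pass: `7` test, `1` sequencing, `5 + opCost K` random choice, `8` increment.
    calc (Test.cost k K (.lt (natVar 7) dimExpr) : ℝ≥0∞) + _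
        ≤ ((7 : ℕ) : ℝ≥0∞) + (1 + (((5 + opCost K : ℕ) : ℝ≥0∞)
          + (((8 + (j * (opCost K + 21) + 7) : ℕ) : ℝ≥0∞)
            + randomCompletion H i (τ.row d 5 0)))) := by
          refine add_le_add (by simp [Test.cost, IExpr.cost]) ?_
          rw [ert]
          refine add_le_add_right ?_ _
          rw [ert]
          refine add_le_add ?_ hsum
          simp only [Ref.cost, IExpr.cost]
          norm_num
      _ = _ := by
          push_cast
          ring

theorem ert_randomRowCmd_le (hd : 1 ≤ d) (f : State k K → ℝ≥0∞) (H : (Fin d → K) → ℝ≥0∞)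
    (hdim : σ.nat 0 1 0 = d) (hf : ∀ τ, Mod [7] [5] σ τ → f τ ≤ H (τ.row d 5 0)) :
    ert pb randomRowCmd f σ ≤ ((40 * (d * opCost K) : ℕ) : ℝ≥0∞)
      + (∑ v, H v) / (Fintype.card (Fin d → K) : ℝ≥0∞) := by
  have hκ : 1 ≤ opCost K := one_le_opCost K
  have h := ert_randomRow_loop_le (pb := pb) f H hdim hf d 0 (by omega)
    { σ with nat := σ.nat.set 7 0 0 0 } (Mod.refl.set_nat (by simp) _ _ _)
    (by simp [Mem.set_self])
  simp only [randomCompletion, Nat.not_lt_zero, if_false] at h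
  rw [randomRowCmd, forLoop, ert]
  have h5 : ert pb (.natSet (scalar 7) (.lit 0)) (ert pb (.loop (.lt (natVar 7) dimExpr)
      (.seq (.rand ⟨5, .lit 0, natVar 7⟩) (.natSet (scalar 7) (.add (natVar 7) (.lit 1))))) f) σ
      ≤ ((4 : ℕ) : ℝ≥0∞) + (((d * (opCost K + 21) + 7 : ℕ) : ℝ≥0∞)
        + (∑ v, H v) / (Fintype.card (Fin d → K) : ℝ≥0∞)) := by
    rw [ert]
    · exact add_le_add (by simp [stepCost, Ref.cost, IExpr.cost]) h
    all_goals simp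
  refine (add_le_add_right h5 1).trans ?_
  rw [← add_assoc, ← add_assoc]
  refine add_le_add_left ?_ _
  have h6 : 1 + 4 + (d * (opCost K + 21) + 7) ≤ 40 * (d * opCost K) := by
    nlinarith [Nat.mul_le_mul_left d hκ, Nat.mul_le_mul hd hκ]
  exact_mod_cast h6

variable [Finite k]

open Classical in
-- A penalty `2 * B` incurred with probability at most `1/2` costs at most `B` on average.
theorem sum_twistedTrace_mem_le (a B : ℕ) {S : Submodule K (Fin d → K)} (hS : S ≠ ⊤) :
    (∑ v, ((a + if twistedTrace k M (Module.finrank k K) v ∈ S then 2 * B else 0 : ℕ) : ℝ≥0∞))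
      / (Fintype.card (Fin d → K) : ℝ≥0∞) ≤ ((a + B : ℕ) : ℝ≥0∞) := by
  refine ENNReal.div_le_of_le_mul ?_
  have h := two_mul_card_twistedTrace_mem_le k M hS
  rw [Nat.card_eq_fintype_card, Nat.card_eq_fintype_card, Fintype.card_subtype] at h
  have h2 := Nat.mul_le_mul_right B h
  rw [← Nat.cast_sum, ← Nat.cast_mul]
  refine Nat.cast_le.2 ?_
  rw [Finset.sum_add_distrib, Finset.sum_const, ← Finset.sum_filter, Finset.sum_const,
    Finset.card_univ, smul_eq_mul, smul_eq_mul]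
  nlinarith

theorem ert_lasVegas_loop_le (hq : 2 ≤ q) (hd : 1 ≤ d) (hn : 1 ≤ n) (hk : q = Nat.card k)
    (hdeg : Module.finrank k K = n) (hfix : ∀ v, (twist k M)^[n] v = v) :
    ∀ τ, ert pb (.loop (.lt (natVar 4) dimExpr) (.seq randomRowCmd processCmd)) (failure M) τ
      ≤ potential q n (1600 * (n * (d * d * (Nat.clog 2 q * opCost K)))) M τ := by
  classical
  have hκ : 1 ≤ opCost K := one_le_opCost K
  have hL : 1 ≤ Nat.clog 2 q := Nat.clog_pos one_lt_two hq
  have hX : 1 * (d * 1 * (1 * opCost K)) ≤ n * (d * d * (Nat.clog 2 q * opCost K)) :=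
    Nat.mul_le_mul hn (Nat.mul_le_mul (Nat.mul_le_mul_left _ hd) (Nat.mul_le_mul_right _ hL))
  have hdκ : 1 * 1 ≤ d * opCost K := Nat.mul_le_mul hd hκ
  simp only [one_mul, mul_one] at hX hdκ
  set X := n * (d * d * (Nat.clog 2 q * opCost K)) with hXdef
  set B := 1600 * X with hB
  have hcost : Test.cost k K (.lt (natVar 4) dimExpr) = 7 := by simp [Test.cost, IExpr.cost]
  refine ert_loop_le pb fun τ => ?_
  by_cases hinv : HasInput q n M τ ∧ τ.IsReduced M
  swap
  · rw [potential, if_neg hinv]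
    exact le_top
  obtain ⟨h, hred⟩ := hinv
  have hm : τ.nat 4 0 0 ≤ d := IsEchelon.le hred
  rw [potential_of h hred, hcost]
  rcases hm.lt_or_eq with hlt | heq
  · have ht : (Test.lt (natVar 4) dimExpr).eval τ = true := by
      simp [Test.eval, IExpr.eval, h.dim, hlt]
    rw [ht]
    simp only [if_true]
    have hS : τ.rowSpan d ≠ ⊤ := fun hS => hlt.ne (IsEchelon.eq_of_span_eq_top hred hS)
    obtain ⟨e, he⟩ : ∃ e, d - τ.nat 4 0 0 = e + 1 := ⟨d - τ.nat 4 0 0 - 1, by omega⟩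
    -- With `e + 1` rows missing, a trace outside the current span brings the potential down to at
    -- most `7 + 2 * B * e`; otherwise up to `2 * B` more remains. On average this extra is at most
    -- `B`, and the other `B` of the row's allowance pays for the trial itself.
    have hproc : ∀ υ, Mod [7] [5] τ υ → ert pb processCmd (potential q n B M) υ
        ≤ ((1500 * X + (7 + 2 * B * e) + if twistedTrace k M (Module.finrank k K) (υ.row d 5 0)
          ∈ τ.rowSpan d then 2 * B else 0 : ℕ) : ℝ≥0∞) := by
      intro υ hυ
      have hr : ∀ A ∉ [5], ∀ x, υ.row d A x = τ.row d A x := fun A hA => State.row_of_mod hυ hA d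
      have hspan : υ.rowSpan d = τ.rowSpan d := by simp only [State.rowSpan, hr 3 (by simp)]
      have hred' : υ.IsReduced M := by
        simpa only [State.IsReduced, hr 3 (by simp), hr 1 (by simp), hυ.nat 4 (by simp)] using hred
      have hυ' := h.of_mod hυ (by simp) (by simp)
      obtain ⟨ω, h1, h2, h3, -, -, h4, h5⟩ :=
        trip_processCmd (pb := pb) hq hd hn hk hυ' hred' hfix
      refine (h1 _).trans ?_
      rw [potential_of (hυ'.of_mod h2 (by simp) (by simp)) h3, ← Nat.cast_add]
      refine Nat.cast_le.2 ?_
      rw [hspan] at h5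
      rw [hυ.nat 4 (by simp)] at h4 h5
      rw [hdeg]
      split_ifs with hmem
      · have : 2 * B * (d - ω.nat 4 0 0) ≤ 2 * B * (e + 1) := Nat.mul_le_mul_left _ (by omega)
        rw [Nat.mul_succ] at this
        omega
      · have := h5 hmem
        have : 2 * B * (d - ω.nat 4 0 0) ≤ 2 * B * e := Nat.mul_le_mul_left _ (by omega)
        omega
    rw [ert]
    have hrow := ert_randomRowCmd_le (pb := pb) hd _ (fun v => ((1500 * X + (7 + 2 * B * e)
      + if twistedTrace k M (Module.finrank k K) v ∈ τ.rowSpan d then 2 * B else 0 : ℕ) : ℝ≥0∞))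
      h.dim hproc
    have hrow' := hrow.trans (add_le_add_right
      (sum_twistedTrace_mem_le (1500 * X + (7 + 2 * B * e)) B hS) _)
    refine (add_le_add_right (add_le_add_right hrow' 1) _).trans ?_
    rw [he, Nat.mul_succ]
    have hnum : 7 + (1 + (40 * (d * opCost K) + (1500 * X + (7 + 2 * B * e) + B)))
        ≤ 7 + (2 * B * e + 2 * B) := by omega
    exact_mod_cast hnum
  · have ht : (Test.lt (natVar 4) dimExpr).eval τ = false := by
      simp [Test.eval, IExpr.eval, h.dim, heq]
    rw [ht, if_neg Bool.false_ne_true, failure, if_pos ⟨hred, heq⟩]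
    simp

theorem ert_lasVegasCmd_le (hq : 2 ≤ q) (hd : 1 ≤ d) (hr : 1 ≤ r) (hs : 1 ≤ s)
    (hk : q = Nat.card k) (hn : Module.finrank k K = r * s)
    (hfix : ∀ v, (twist k M)^[Module.finrank k K] v = v) :
    ert pb lasVegasCmd (failure M) (initState q r s M)
      ≤ ((4000 * (d * (r * s * (d * d * (Nat.clog 2 q * opCost K)))) : ℕ) : ℝ≥0∞) := by
  have hκ : 1 ≤ opCost K := one_le_opCost K
  have hL : 1 ≤ Nat.clog 2 q := Nat.clog_pos one_lt_two hq
  have hsn : 1 * s ≤ r * s := Nat.mul_le_mul_right _ hr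
  rw [hn] at hfix
  obtain ⟨τ, h1, h2, h3⟩ := trip_degreeCmd (pb := pb) (q := q) (M := M) (n := r * s) rfl
  rw [lasVegasCmd, ert]
  set n := r * s
  have hX : 1 * (n * (1 * 1 * (1 * 1))) ≤ d * (n * (d * d * (Nat.clog 2 q * opCost K))) :=
    Nat.mul_le_mul hd (Nat.mul_le_mul_left _
      (Nat.mul_le_mul (Nat.mul_le_mul hd hd) (Nat.mul_le_mul hL hκ)))
  simp only [one_mul, mul_one] at hX hsn
  have hloop := ert_lasVegas_loop_le (pb := pb) (M := M) hq hd (by omega) hk hn hfix τ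
  rw [potential_of h2 h3] at hloop
  refine (add_le_add_right ((h1 _).trans (add_le_add_right hloop _)) 1).trans ?_
  have h4 : 1 + ((40 * s + 12) + (7 + 2 * (1600 * (n * (d * d * (Nat.clog 2 q * opCost K))))
      * (d - τ.nat 4 0 0))) ≤ 4000 * (d * (n * (d * d * (Nat.clog 2 q * opCost K)))) := by
    have h5 : 2 * (1600 * (n * (d * d * (Nat.clog 2 q * opCost K)))) * (d - τ.nat 4 0 0)
        ≤ 2 * (1600 * (n * (d * d * (Nat.clog 2 q * opCost K)))) * d :=
      Nat.mul_le_mul_left _ (by omega)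
    have h6 : 2 * (1600 * (n * (d * d * (Nat.clog 2 q * opCost K)))) * d
        = 3200 * (d * (n * (d * d * (Nat.clog 2 q * opCost K)))) := by ring
    omega
  exact_mod_cast h4

end LasVegas

/-! ### From operation counts to the stated bounds. -/

section MainTheorem

theorem deterministic_deterministicCmd : deterministicCmd.Deterministic := by
  simp [Cmd.Deterministic, deterministicCmd, degreeCmd, forLoop, multiplesCmd, singleCmd,
    processCmd, traceCmd, addRowCmd, frobRowCmd, powCmd, powUpBody, powDownBody, mulRowCmd, dotCmd,
    reduceCmd, insertCmd, eliminateCmd]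

/-- This converts operations in `K` to time in terms of `q`, at the price of one factor `n` and one
factor `log q`. -/
theorem opCost_le {k K : Type*} [Field k] [Field K] [Algebra k K] [Finite K] :
    opCost K ≤ Module.finrank k K * Nat.clog 2 (Nat.card k) := by
  refine Nat.clog_le_of_le_pow ?_
  rw [Module.natCard_eq_pow_finrank (K := k), mul_comm, pow_mul]
  exact Nat.pow_le_pow_left (Nat.le_pow_clog one_lt_two _) _

/-- Rounding up adds at most `1 ≤ log q / log 2`, and `2 / log 2 < 3`. Squaring gives the factor `9`
in the final constants. -/
theorem clog_two_le_log {q : ℕ} (hq : 2 ≤ q) : (Nat.clog 2 q : ℝ) ≤ 3 * Real.log q := by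
  have h1 : 2 ^ (Nat.clog 2 q - 1) < q := by
    by_contra h
    have h2 := Nat.clog_le_of_le_pow (b := 2) (not_lt.1 h)
    have h3 : 1 ≤ Nat.clog 2 q := Nat.clog_pos one_lt_two hq
    omega
  have h3 : 1 ≤ Nat.clog 2 q := Nat.clog_pos one_lt_two hq
  have h4 : ((Nat.clog 2 q - 1 : ℕ) : ℝ) * Real.log 2 ≤ Real.log q := by
    rw [← Real.log_pow]
    exact Real.log_le_log (by positivity) (by exact_mod_cast h1.le)
  have h5 : Real.log 2 ≤ Real.log q := Real.log_le_log two_pos (by exact_mod_cast hq)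
  rw [Nat.cast_sub h3] at h4
  have h6 := Real.log_two_gt_d9
  have h7 : (0 : ℝ) ≤ Nat.clog 2 q := Nat.cast_nonneg _
  push_cast at h4
  nlinarith

theorem natCast_le_ofReal {A T x : ℕ} {y : ℝ} {q : ℕ} (hq : 2 ≤ q)
    (hT : T ≤ A * (x * Nat.clog 2 q ^ 2)) (hx : (x : ℝ) = y) :
    (T : ℝ≥0∞) ≤ ENNReal.ofReal (9 * A * (y * Real.log q ^ 2)) := by
  rw [← ENNReal.ofReal_natCast]
  refine ENNReal.ofReal_le_ofReal ?_
  have h1 : (T : ℝ) ≤ A * (x * (Nat.clog 2 q : ℝ) ^ 2) := by exact_mod_cast hT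
  have h2 : (Nat.clog 2 q : ℝ) ^ 2 ≤ (3 * Real.log q) ^ 2 :=
    pow_le_pow_left₀ (Nat.cast_nonneg _) (clog_two_le_log hq) 2
  calc (T : ℝ) ≤ A * (x * (Nat.clog 2 q : ℝ) ^ 2) := h1
    _ ≤ A * (x * (3 * Real.log q) ^ 2) := by gcongr
    _ = 9 * A * (y * Real.log q ^ 2) := by
      rw [hx]
      ring

/-- A program whose expected running time plus the value of `failure` at the final state is
bounded computes bases of the spaces of `F`-eigenvectors. -/
theorem computesFEigenbasis_of_ert_le {P : Cmd} {T : ℕ → ℕ → ℕ → ℕ → ℝ}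
    (h : ∀ (k K : Type u) [Field k] [Field K] [Algebra k K] [Finite k] [Finite K]
      (pb : PowerBasis k K) (d r s : ℕ) (M : Matrix (Fin d) (Fin d) K),
      1 ≤ d → 1 ≤ r → 1 ≤ s → Module.finrank k K = r * s →
      (∀ v, (twist k M)^[Module.finrank k K] v = v) →
      ert pb P (failure M) (initState (Nat.card k) r s M)
        ≤ ENNReal.ofReal (T d r s (Nat.card k))) :
    ComputesFEigenbasis.{u} P T := by
  intro k _ _ N d G V c r s _ hd hr hs K pb hK
  have : Module.Finite k K := pb.finite
  have : Finite K := Module.finite_of_finite k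
  have hpos : 0 < r * s := hK ▸ Module.finrank_pos
  obtain ⟨M, hM⟩ := exists_matrix V hr.1.2 hK
  have hfix := iterate_twist_eq_self hr.1.2 hs hK hM
  have hert := h k K pb d r s M hd (Nat.pos_of_mul_pos_right hpos) (Nat.pos_of_mul_pos_left hpos)
    hK hfix
  refine ⟨M, hM, (expectedTime_le_ert pb _ P _).trans hert, fun σ hσ => ?_⟩
  -- The bound is finite and `failure` is `∞` on bad states, so every reachable halting state is
  -- good.
  have hlt := lt_top_of_reaches pb _ (hert.trans_lt ENNReal.ofReal_lt_top) hσ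
  have hgood : σ.IsReduced M ∧ σ.nat 4 0 0 = d := by
    by_contra hbad
    rw [failure, if_neg hbad] at hlt
    exact lt_irrefl _ hlt
  obtain ⟨hred, hcard⟩ := hgood
  rw [State.IsReduced, hcard] at hred
  refine exists_basis_fEigenvectors hM (σ.output d) (fun i => hred.fixed i i.2) ?_
  rw [← hred.span_eq_top, hred.span]
  congr 1
  ext v
  simp only [Set.mem_image, Set.mem_Iio]
  constructor
  · rintro ⟨i, rfl⟩
    exact ⟨i, i.2, rfl⟩
  · rintro ⟨i, hi, rfl⟩
    exact ⟨⟨i, hi⟩, rfl⟩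

/-- The three factors `n = r * s` come from the number `n * d` of traces, the `n` iterates in each,
and the cost of an operation in `K`. -/
theorem computesFEigenbasis_deterministicCmd :
    ComputesFEigenbasis.{u} deterministicCmd (fun d r s q =>
      9 * (2000 : ℕ) * ((d : ℝ) ^ 3 * (r : ℝ) ^ 3 * (s : ℝ) ^ 3 * Real.log q ^ 2)) := by
  refine computesFEigenbasis_of_ert_le fun k K _ _ _ _ _ pb d r s M hd hr hs hn hfix => ?_
  have hq : 2 ≤ Nat.card k := Finite.one_lt_card
  obtain ⟨τ, h1, h2⟩ := trip_deterministicCmd (pb := pb) hq hd hr hs rfl hn hfix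
  refine (h1 _).trans ?_
  rw [failure, if_pos h2, add_zero]
  refine natCast_le_ofReal (x := d ^ 3 * r ^ 3 * s ^ 3) hq (Nat.mul_le_mul_left _ ?_)
    (by push_cast; rfl)
  have hκ : opCost K ≤ r * s * Nat.clog 2 (Nat.card k) := hn ▸ opCost_le
  calc r * s * (d * (r * s * (d * d * (Nat.clog 2 (Nat.card k) * opCost K))))
      ≤ r * s * (d * (r * s * (d * d * (Nat.clog 2 (Nat.card k)
        * (r * s * Nat.clog 2 (Nat.card k)))))) := by gcongr
    _ = _ := by ring

/-- One factor `r * s` is saved because about `2 * d` random traces replace the `n * d` systematic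
ones. -/
theorem computesFEigenbasis_lasVegasCmd :
    ComputesFEigenbasis.{u} lasVegasCmd (fun d r s q =>
      9 * (4000 : ℕ) * ((d : ℝ) ^ 3 * (r : ℝ) ^ 2 * (s : ℝ) ^ 2 * Real.log q ^ 2)) := by
  refine computesFEigenbasis_of_ert_le fun k K _ _ _ _ _ pb d r s M hd hr hs hn hfix => ?_
  have hq : 2 ≤ Nat.card k := Finite.one_lt_card
  have := Fintype.ofFinite K
  refine (ert_lasVegasCmd_le hq hd hr hs rfl hn hfix).trans ?_
  refine natCast_le_ofReal (x := d ^ 3 * r ^ 2 * s ^ 2) hq (Nat.mul_le_mul_left _ ?_)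
    (by push_cast; rfl)
  have hκ : opCost K ≤ r * s * Nat.clog 2 (Nat.card k) := hn ▸ opCost_le
  calc d * (r * s * (d * d * (Nat.clog 2 (Nat.card k) * opCost K)))
      ≤ d * (r * s * (d * d * (Nat.clog 2 (Nat.card k)
        * (r * s * Nat.clog 2 (Nat.card k))))) := by gcongr
    _ = _ := by ring

end MainTheorem

end LangAlg

end

theorem mainTheorem4 :
    (∃ (P : LangAlg.Cmd) (C : ℝ), P.Deterministic ∧
      LangAlg.ComputesFEigenbasis.{u} P
        (fun d r s q => C * ((d : ℝ) ^ 3 * (r : ℝ) ^ 3 * (s : ℝ) ^ 3 * Real.log q ^ 2))) ∧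
    (∃ (P : LangAlg.Cmd) (C : ℝ),
      LangAlg.ComputesFEigenbasis.{u} P
        (fun d r s q => C * ((d : ℝ) ^ 3 * (r : ℝ) ^ 2 * (s : ℝ) ^ 2 * Real.log q ^ 2))) :=
  ⟨⟨LangAlg.deterministicCmd, _, LangAlg.deterministic_deterministicCmd,
    LangAlg.computesFEigenbasis_deterministicCmd⟩,
    ⟨LangAlg.lasVegasCmd, _, LangAlg.computesFEigenbasis_lasVegasCmd⟩⟩
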